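/- **Setting.** Let $f:\mathbb R^n\to\mathbb R\cup\{\pm\infty\}$, $\bar x\in\mathbb R^n$, and $k\in\{1,2,\dots\}\cup\{\infty\}$. $\hat\partial f$ and $\partial f$ are the regular (Fréchet) and the limiting subdifferential, and $\hat N_C$, $N_C$ the regular and the limiting normal cone of a set $C$. A set is Clarke regular at a point $x$ of it if it is locally closed there and $N_C(x)=\hat N_C(x)$; $f$ is subdifferentially regular at $x$ if $f(x)$ is finite and $\operatorname{epi} f$ is Clarke regular at $(x,f(x))$. Put $$\mathcal V=\operatorname{span}(\partial f(\bar x)-\tilde g)\ \ (\tilde g\in\partial f(\bar x)\text{ arbitrary}),\qquad \mathcal U=\mathcal V^\perp .$$ Write $P_{\mathcal V}$ for the orthogonal projection onto $\mathcal V$. Let $\bar U:\mathbb R^m\to\mathcal U$, $\bar V:\mathbb R^p\to\mathcal V$ be linear bijections (basis matrices). For $\epsilon>0$ put $$\epsilon\text{-ri}\,\partial f(\bar x)=\{g:\ g+w\in\partial f(\bar x)\ \text{for all } w\in\mathcal V,\ \|w\|<\epsilon\},$$ and for $g\in\epsilon\text{-ri}\,\partial f(\bar x)$, $u\in\mathbb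 R^m$, $$L_\epsilon(u;g_v)=\inf_{\|\bar Vv\|\le\epsilon}\{f(\bar x+\bar Uu+\bar Vv)-\langle g,\bar Vv\rangle\},$$ with $W(u;g_v)$ the set of minimizers $v$ ($\|\bar Vv\|\le\epsilon$) of this problem, empty when the infimum is $+\infty$. *Prox-regularity.* $f$ is prox-regular at $\bar x$ for $\bar w\in\partial f(\bar x)$ with respect to $r>0$, $\rho\ge0$ if $f$ is finite and locally l.s.c. at $\bar x$ and $f(x')\ge f(x)+\langle w,x'-x\rangle-\frac\rho2\|x'-x\|^2$ for all $\|x'-\bar x\|\le r$ whenever $w\in\partial f(x)$, $\|w-\bar w\|<r$, $\|x-\bar x\|<r$, $f(x)<f(\bar x)+r$. A set $C$ is prox-regular at a point of $C$ for a vector $w$ of its limiting normal cone there if its indicator function is (for some constants). $f$ is properly prox-regular at $\bar x$ with respect to $r,\rho$ if it is finite and locally l.s.c. at $\bar x$, prox-regular at $\bar x$ with respect to $r,\rho$ for every $g\in\partial f(\bar x)$, and $\operatorname{epi}f$ is prox-regular at $(\bar x,f(\bar x))$ for every $(g,-1)\in N_{\operatorname{epi} f}(\bar x,f(\bar x))$.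 *Fast track.* For $\delta>0$ and $v:\mathbb R^m\to\mathbb R^p$, the set $\mathcal M=\{\bar x+\bar Uu+\bar Vv(u):\ \|\bar Uu\|\le\delta\}$ is a $C^k$ fast track of $f$ if on some neighbourhood of $u=0$: (i) $v$ is $C^k$ and $v(u)\in W(u;g_v)$ for every $g\in\epsilon\text{-ri}\,\partial f(\bar x)$; (ii) for some $\hat g\in\epsilon\text{-ri}\,\partial f(\bar x)$ the function $L_\epsilon(\cdot;\hat g_v)$ is real-valued and $C^k$. **Theorem.** Let $\bar x$ be a local minimizer of $f$, $\epsilon>0$, $\bar g\in\epsilon\text{-ri}\,\partial f(\bar x)$, and let $\mathcal M=\{\bar x+\bar Uu+\bar Vv(u):\|\bar Uu\|\le\delta\}$ be a $C^k$ fast track of $f$. Assume: 1. $f$ is proper, l.s.c. on $\mathbb R^n$ and properly prox-regular at $\bar x$ with respect to $\bar\epsilon$ and $\rho$; 2. $0<\rho<2$ and $\epsilon<\bar\epsilon$; 3. there is $\tau\in(0,\delta]$ such that, for all $u$ with $\|\bar Uu\|\le\tau$, $W(u;\bar g_v)$ contains a $w$ with $\|\bar Vw\|<\epsilon$, and $\|\bar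 Vv(u)\|<\epsilon$; 4. $P_{\mathcal V}\big(\partial f(\bar x)\setminus\epsilon\text{-ri}\,\partial f(\bar x)\big)\subset\liminf_{x\to\bar x,\,x\in\mathcal M}P_{\mathcal V}(\partial f(x))$ (inner limit); 5. there is $\bar\delta>0$ such that, at every $x\in\mathcal M$ with $\|x-\bar x\|\le\bar\delta$, $f$ is subdifferentially regular and $\partial f(x)\ne\emptyset$. Then $f$ is $C^k$-partly smooth at $\bar x$ relative to $\mathcal M$; that is, $\mathcal M$ is a $C^k$-smooth manifold around $\bar x$ (on an open neighbourhood of $\bar x$ it is the common zero set of finitely many real-valued $C^k$ functions whose gradients at $\bar x$ are linearly independent), and (i) some real-valued $C^k$ function on an open neighbourhood $\mathcal N$ of $\bar x$ agrees with $f$ on $\mathcal M\cap\mathcal N$; (ii) at every point of $\mathcal M$ close to $\bar x$, $f$ is subdifferentially regular and has a subgradient; (iii) $N_{\mathcal M}(\bar x)=\mathcal V$; (iv) $\partial f$ is continuous (inner and outer semicontinuous) at $\bar x$ relative to $\mathcal M$. -/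

import Mathlib

open Set Filter Topology

noncomputable section

namespace UVDecomp

section General

variable {E : Type*} [NormedAddCommGroup E] [InnerProductSpace ℝ E]

/-- `f x` is a real number. -/
def FiniteAt (f : E → EReal) (x : E) : Prop := f x ≠ ⊤ ∧ f x ≠ ⊥

/-- A proper extended-real-valued function. -/
def Proper (f : E → EReal) : Prop := (∀ x, f x ≠ ⊥) ∧ ∃ x, f x ≠ ⊤

/-- Regular (Fréchet) subdifferential:
`f x' ≥ f x + ⟪v, x' - x⟫ + o(‖x' - x‖)`, with `f x` finite. -/
def regSubdiff (f : E → EReal) (x : E) : Set E :=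
  {v | FiniteAt f x ∧ ∀ η : ℝ, 0 < η → ∀ᶠ x' in 𝓝 x,
    (((f x).toReal + inner ℝ v (x' - x) - η * ‖x' - x‖ : ℝ) : EReal) ≤ f x'}

/-- Limiting subdifferential: limits of regular subgradients along `f`-attentive sequences. -/
def limSubdiff (f : E → EReal) (x : E) : Set E :=
  {v | FiniteAt f x ∧ ∃ (xs : ℕ → E) (vs : ℕ → E),
    Tendsto xs atTop (𝓝 x) ∧ Tendsto (fun j => f (xs j)) atTop (𝓝 (f x)) ∧
    (∀ j, vs j ∈ regSubdiff f (xs j)) ∧ Tendsto vs atTop (𝓝 v)}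

/-- Regular (Fréchet) normal cone; empty outside `C`. -/
def regNormal (C : Set E) (x : E) : Set E :=
  {v | x ∈ C ∧ ∀ η : ℝ, 0 < η → ∀ᶠ x' in 𝓝[C] x, inner ℝ v (x' - x) ≤ η * ‖x' - x‖}

/-- Limiting normal cone; empty outside `C`. -/
def limNormal (C : Set E) (x : E) : Set E :=
  {v | x ∈ C ∧ ∃ (xs : ℕ → E) (vs : ℕ → E),
    Tendsto xs atTop (𝓝 x) ∧ (∀ j, vs j ∈ regNormal C (xs j)) ∧ Tendsto vs atTop (𝓝 v)}

/-- `C ∩ N` is closed for some closed neighbourhood `N` of `x`. -/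
def LocallyClosedAt (C : Set E) (x : E) : Prop :=
  ∃ N ∈ 𝓝 x, IsClosed N ∧ IsClosed (C ∩ N)

/-- Clarke regularity of a set at one of its points. -/
def ClarkeRegularAt (C : Set E) (x : E) : Prop :=
  x ∈ C ∧ LocallyClosedAt C x ∧ limNormal C x = regNormal C x

/-- The epigraph, as a subset of `E × ℝ` with the Euclidean product norm. -/
def epi (f : E → EReal) : Set (WithLp 2 (E × ℝ)) := {z | f z.fst ≤ (z.snd : EReal)}

/-- The point `(x, f x)` of the epigraph (meaningful where `f x` is finite). -/
def epiPoint (f : E → EReal) (x : E) : WithLp 2 (E × ℝ) := WithLp.toLp 2 (x, (f x).toReal)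

/-- Subdifferential regularity: `f x` is finite and the epigraph is Clarke regular
at `(x, f x)`. -/
def SubdiffRegularAt (f : E → EReal) (x : E) : Prop :=
  FiniteAt f x ∧ ClarkeRegularAt (epi f) (epiPoint f x)

/-- Local lower semicontinuity at a point where `f` is finite, i.e. local closedness of the
epigraph at `(x, f x)`. -/
def LocallyLscAt (f : E → EReal) (x : E) : Prop :=
  FiniteAt f x ∧ LocallyClosedAt (epi f) (epiPoint f x)

/-- `f` is prox-regular at `x₀` for `w₀` with respect to the constants `r` and `ρ`. -/
def ProxRegularWith (f : E → EReal) (x₀ w₀ : E) (r ρ : ℝ) : Prop :=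
  LocallyLscAt f x₀ ∧ w₀ ∈ limSubdiff f x₀ ∧ 0 < r ∧ 0 ≤ ρ ∧
    ∀ x w : E, w ∈ limSubdiff f x → ‖w - w₀‖ < r → ‖x - x₀‖ < r →
      f x < f x₀ + (r : EReal) → ∀ x' : E, ‖x' - x₀‖ ≤ r →
        (((f x).toReal + inner ℝ w (x' - x) - ρ / 2 * ‖x' - x‖ ^ 2 : ℝ) : EReal) ≤ f x'

/-- `f` is prox-regular at `x₀` for `w₀`. -/
def ProxRegularAt (f : E → EReal) (x₀ w₀ : E) : Prop :=
  ∃ r ρ : ℝ, ProxRegularWith f x₀ w₀ r ρ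

open Classical in
/-- The indicator function `δ_C`, equal to `0` on `C` and `∞` elsewhere. -/
def indicatorFn (C : Set E) (x : E) : EReal := if x ∈ C then 0 else ⊤

/-- A set is prox-regular at `x₀` for a normal `w₀` if its indicator function is. -/
def SetProxRegularAt (C : Set E) (x₀ w₀ : E) : Prop :=
  x₀ ∈ C ∧ w₀ ∈ limNormal C x₀ ∧ ProxRegularAt (indicatorFn C) x₀ w₀

/-- `f` is properly prox-regular at `x₀` with respect to the constants `r` and `ρ`. -/
def ProperlyProxRegularWith (f : E → EReal) (x₀ : E) (r ρ : ℝ) : Prop :=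
  LocallyLscAt f x₀ ∧ 0 < r ∧ 0 ≤ ρ ∧
    (∀ g ∈ limSubdiff f x₀, ProxRegularWith f x₀ g r ρ) ∧
    (∀ g : E, (WithLp.toLp 2 (g, (-1 : ℝ)) : WithLp 2 (E × ℝ)) ∈
        limNormal (epi f) (epiPoint f x₀) →
      SetProxRegularAt (epi f) (epiPoint f x₀) (WithLp.toLp 2 (g, (-1 : ℝ))))

/-- Inner limit of the set-valued map `S` at `x₀` relative to `M`. -/
def innerLimit (S : E → Set E) (M : Set E) (x₀ : E) : Set E :=
  {y | ∀ xs : ℕ → E, (∀ j, xs j ∈ M) → Tendsto xs atTop (𝓝 x₀) →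
    ∃ ys : ℕ → E, (∀ᶠ j in atTop, ys j ∈ S (xs j)) ∧ Tendsto ys atTop (𝓝 y)}

/-- Outer limit of the set-valued map `S` at `x₀` relative to `M`. -/
def outerLimit (S : E → Set E) (M : Set E) (x₀ : E) : Set E :=
  {y | ∃ xs ys : ℕ → E, (∀ j, xs j ∈ M) ∧ Tendsto xs atTop (𝓝 x₀) ∧
    (∀ j, ys j ∈ S (xs j)) ∧ Tendsto ys atTop (𝓝 y)}

/-- Continuity (inner and outer semicontinuity) of `S` at `x₀` relative to `M`. -/
def SetValuedContinuousAt (S : E → Set E) (M : Set E) (x₀ : E) : Prop :=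
  S x₀ ⊆ innerLimit S M x₀ ∧ outerLimit S M x₀ ⊆ S x₀

/-- `M` is a `C^k`-smooth manifold of codimension `d` around `y₀ ∈ M`. -/
def IsManifoldAround (k : ℕ∞) (M : Set E) (y₀ : E) (d : ℕ) : Prop :=
  y₀ ∈ M ∧ ∃ Q : Set E, IsOpen Q ∧ y₀ ∈ Q ∧ ∃ φ : Fin d → E → ℝ,
    (∀ i, ContDiffOn ℝ k (φ i) Q) ∧
    M ∩ Q = {y | y ∈ Q ∧ ∀ i, φ i y = 0} ∧
    LinearIndependent ℝ (fun i => fderiv ℝ (φ i) y₀)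

/-- The subspace `𝒱(x)`: the span of `∂f(x) - g` for any subgradient `g`
(see `vSpace_eq_span`). -/
def vSpace (f : E → EReal) (x : E) : Submodule ℝ E := vectorSpan ℝ (limSubdiff f x)

theorem vSpace_eq_span (f : E → EReal) (x g : E) (hg : g ∈ limSubdiff f x) :
    vSpace f x = Submodule.span ℝ ((fun y => y - g) '' limSubdiff f x) :=
  vectorSpan_eq_span_vsub_set_right ℝ hg

/-- The subspace `𝒰(x)`, the orthogonal complement of `𝒱(x)`. -/
def uSpace (f : E → EReal) (x : E) : Submodule ℝ E := (vSpace f x)ᗮ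

/-- The `ε`-relative interior of `∂f(x)`. -/
def epsRi (f : E → EReal) (x : E) (ε : ℝ) : Set E :=
  {g | ∀ w ∈ vSpace f x, ‖w‖ < ε → g + w ∈ limSubdiff f x}

/-- `f` is `C^k`-partly smooth at `x₀` relative to the `C^k`-smooth manifold `M`. -/
structure PartlySmooth (k : ℕ∞) (f : E → EReal) (x₀ : E) (M : Set E) : Prop where
  manifold : ∃ d : ℕ, IsManifoldAround k M x₀ d
  smooth : ∃ N : Set E, IsOpen N ∧ x₀ ∈ N ∧ ∃ g : E → ℝ, ContDiffOn ℝ k g N ∧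
    ∀ x ∈ M ∩ N, f x = (g x : EReal)
  regular : ∀ᶠ x in 𝓝[M] x₀, SubdiffRegularAt f x ∧ (limSubdiff f x).Nonempty
  sharp : limNormal M x₀ = (vSpace f x₀ : Set E)
  continuous : SetValuedContinuousAt (limSubdiff f) M x₀

/-! The basis matrices `Ū` and `V̄` of `𝒰(x₀)` and `𝒱(x₀)` are regarded as linear
isomorphisms from `ℝᵐ` onto `𝒰(x₀)` and from `ℝᵖ` onto `𝒱(x₀)`. -/

variable {m p : ℕ}

/-- The objective `f (x₀ + Ū u + V̄ v) - ⟪g, V̄ v⟫` of the `𝒰`-Lagrangian. -/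
def lagObj (f : E → EReal) (x₀ : E)
    (Ubar : EuclideanSpace ℝ (Fin m) ≃ₗ[ℝ] uSpace f x₀)
    (Vbar : EuclideanSpace ℝ (Fin p) ≃ₗ[ℝ] vSpace f x₀) (g : E)
    (u : EuclideanSpace ℝ (Fin m)) (v : EuclideanSpace ℝ (Fin p)) : EReal :=
  f (x₀ + (Ubar u : E) + (Vbar v : E)) - ((inner ℝ g (Vbar v : E) : ℝ) : EReal)

/-- The `𝒰`-Lagrangian `L_ε(u; g_v)`. -/
def uLagrangian (f : E → EReal) (x₀ : E) (ε : ℝ)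
    (Ubar : EuclideanSpace ℝ (Fin m) ≃ₗ[ℝ] uSpace f x₀)
    (Vbar : EuclideanSpace ℝ (Fin p) ≃ₗ[ℝ] vSpace f x₀) (g : E)
    (u : EuclideanSpace ℝ (Fin m)) : EReal :=
  ⨅ v ∈ {v : EuclideanSpace ℝ (Fin p) | ‖(Vbar v : E)‖ ≤ ε}, lagObj f x₀ Ubar Vbar g u v

/-- The set `W(u; g_v)` of minimizers in the `𝒰`-Lagrangian; it is empty when the infimum
is `∞`. -/
def wSet (f : E → EReal) (x₀ : E) (ε : ℝ)
    (Ubar : EuclideanSpace ℝ (Fin m) ≃ₗ[ℝ] uSpace f x₀)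
    (Vbar : EuclideanSpace ℝ (Fin p) ≃ₗ[ℝ] vSpace f x₀) (g : E)
    (u : EuclideanSpace ℝ (Fin m)) : Set (EuclideanSpace ℝ (Fin p)) :=
  {v | ‖(Vbar v : E)‖ ≤ ε ∧ lagObj f x₀ Ubar Vbar g u v ≠ ⊤ ∧
    lagObj f x₀ Ubar Vbar g u v = uLagrangian f x₀ ε Ubar Vbar g u}

/-- `M = {x₀ + Ū u + V̄ v(u) : ‖Ū u‖ ≤ δ}` is a `C^k` fast track of `f`: for all small `u`,
`v` is `C^k` with `v(u) ∈ W(u; g_v)` for every `g` in the `ε`-relative interior of `∂f(x₀)`,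
and `L_ε(·; ĝ_v)` is a (real-valued) `C^k` function for some `ĝ` in that set. -/
def IsFastTrack (k : ℕ∞) (f : E → EReal) (x₀ : E) (ε : ℝ)
    (Ubar : EuclideanSpace ℝ (Fin m) ≃ₗ[ℝ] uSpace f x₀)
    (Vbar : EuclideanSpace ℝ (Fin p) ≃ₗ[ℝ] vSpace f x₀) (δ : ℝ)
    (v : EuclideanSpace ℝ (Fin m) → EuclideanSpace ℝ (Fin p)) (M : Set E) : Prop :=
  0 < δ ∧
  M = {x | ∃ u, ‖(Ubar u : E)‖ ≤ δ ∧ x = x₀ + (Ubar u : E) + (Vbar (v u) : E)} ∧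
  ∃ η : ℝ, 0 < η ∧
    ContDiffOn ℝ k v {u | ‖(Ubar u : E)‖ < η} ∧
    (∀ u, ‖(Ubar u : E)‖ < η →
      ∀ g ∈ epsRi f x₀ ε, v u ∈ wSet f x₀ ε Ubar Vbar g u) ∧
    ∃ ghat ∈ epsRi f x₀ ε, ∃ l : EuclideanSpace ℝ (Fin m) → ℝ,
      ContDiffOn ℝ k l {u | ‖(Ubar u : E)‖ < η} ∧
      ∀ u, ‖(Ubar u : E)‖ < η → uLagrangian f x₀ ε Ubar Vbar ghat u = (l u : EReal)

end General

end UVDecomp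

end

open UVDecomp

noncomputable section

namespace UVDecomp

/-! Write `K` for $\mathcal V$. Since $\bar x$ is a local minimizer, $0\in\partial f(\bar x)$, so
$\partial f(\bar x)\subset K$. Prox-regularity at $\bar x$, used for all $g+w$ with $w\in K$ small,
gives growth of order $\epsilon\|b\|$ in the directions $b\in K$ up to quadratic terms
(`sharp_growth`). Because $\rho<2$, the negative quadratic term in $b$ cannot absorb this growth
when $\|b\|\le\epsilon$. Hence the smooth Lagrangian $L_\epsilon(\cdot;\hat g_v)$ plus a quadratic
has a local minimum at $0$ and dominates $\|\bar Vv(u)\|$. It follows that $v(0)=0$ and that the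
derivatives of $v$ and of the Lagrangian vanish at $0$ (`isTangentGraph_of_wSet`). So $\mathcal M$
is a graph tangent to $\mathcal U$ at $\bar x$, with normal cone `K`, and along it $f$ is the
Lagrangian plus $\langle\hat g,\bar Vv(u)\rangle$, a smooth function of $u$ stationary at $0$.

Outer semicontinuity of $\partial f$ follows from continuity of $f$ along $\mathcal M$ and
regularity at its points. For inner semicontinuity, only `K`-components matter: smoothness of $f$
along $\mathcal M$ forces the $\mathcal U$-components of subgradients to vanish in the limit
(`IsSmoothAlong.mem_innerLimit`). Outside the $\epsilon$-relative interior, the `K`-components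
converge by assumption. For $g$ inside it, $v(u)$ is an interior minimizer of $f-\langle
g,\cdot\rangle$ on a slice parallel to `K`. A quadratic penalty for leaving the slice turns this
into a subgradient with the same `K`-component as $g$, unless the penalty gradients blow up and
produce a horizontal normal of the epigraph in $\mathcal U$
(`exists_limSubdiff_or_horizontal_normal`). Regularity and smoothness along $\mathcal M$ exclude the
latter (`exists_limSubdiff_starProjection_eq`). -/

theorem FiniteAt.coe_toReal {X : Type*} {f : X → EReal} {x : X} (h : FiniteAt f x) :
    ((f x).toReal : EReal) = f x := EReal.coe_toReal h.1 h.2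

theorem epiPoint_mem_epi {X : Type*} {f : X → EReal} {x : X} (h : FiniteAt f x) :
    epiPoint f x ∈ epi f := by
  change f x ≤ (((f x).toReal : ℝ) : EReal)
  rw [h.coe_toReal]

/-! ### Norm and topology of the Euclidean product containing the epigraph -/

section WithLp

variable {E : Type*} [NormedAddCommGroup E]

theorem norm_fst_le_withLp (z : WithLp 2 (E × ℝ)) : ‖z.fst‖ ≤ ‖z‖ := by
  rw [WithLp.prod_norm_eq_of_L2]
  exact Real.le_sqrt_of_sq_le (by nlinarith [sq_nonneg ‖z.snd‖])

theorem norm_withLp_le (z : WithLp 2 (E × ℝ)) : ‖z‖ ≤ ‖z.fst‖ + ‖z.snd‖ := by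
  rw [WithLp.prod_norm_eq_of_L2]
  apply Real.sqrt_le_iff.2 ⟨by positivity, ?_⟩
  nlinarith [norm_nonneg z.fst, norm_nonneg z.snd]

theorem continuous_withLp_mk {X : Type*} [TopologicalSpace X] {a : X → E} {b : X → ℝ}
    (ha : Continuous a) (hb : Continuous b) :
    Continuous fun x => (WithLp.toLp 2 (a x, b x) : WithLp 2 (E × ℝ)) :=
  (WithLp.prod_continuous_toLp 2 E ℝ).comp (ha.prodMk hb)

theorem tendsto_withLp_mk {X : Type*} {F : Filter X} {a : X → E} {b : X → ℝ} {a₀ : E} {b₀ : ℝ}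
    (ha : Tendsto a F (𝓝 a₀)) (hb : Tendsto b F (𝓝 b₀)) :
    Tendsto (fun x => (WithLp.toLp 2 (a x, b x) : WithLp 2 (E × ℝ))) F
      (𝓝 (WithLp.toLp 2 (a₀, b₀))) :=
  ((WithLp.prod_continuous_toLp 2 E ℝ).tendsto (a₀, b₀)).comp (ha.prodMk_nhds hb)

theorem tendsto_epiPoint {f : E → EReal} {x : E} {xs : ℕ → E} (hx : FiniteAt f x)
    (hxs : Tendsto xs atTop (𝓝 x)) (hf : Tendsto (fun j => f (xs j)) atTop (𝓝 (f x))) :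
    Tendsto (fun j => epiPoint f (xs j)) atTop (𝓝 (epiPoint f x)) :=
  tendsto_withLp_mk hxs ((EReal.tendsto_toReal hx.1 hx.2).comp hf)

end WithLp

/-! ### Subgradients, epigraph normals and tangent curves -/

section Variational

variable {E : Type*} [NormedAddCommGroup E] [InnerProductSpace ℝ E]

theorem inner_withLp_prod (a a' : E) (b b' : ℝ) :
    inner ℝ (WithLp.toLp 2 (a, b) : WithLp 2 (E × ℝ)) (WithLp.toLp 2 (a', b')) =
      inner ℝ a a' + b * b' := by
  simp [WithLp.prod_inner_apply, mul_comm]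

theorem regSubdiff_subset_limSubdiff (f : E → EReal) (x : E) :
    regSubdiff f x ⊆ limSubdiff f x := fun v hv =>
  ⟨hv.1, fun _ => x, fun _ => v, tendsto_const_nhds, tendsto_const_nhds, fun _ => hv,
    tendsto_const_nhds⟩

theorem toLp_mem_regNormal_epi {f : E → EReal} {x v : E} (hv : v ∈ regSubdiff f x) :
    (WithLp.toLp 2 (v, (-1 : ℝ)) : WithLp 2 (E × ℝ)) ∈ regNormal (epi f) (epiPoint f x) := by
  refine ⟨epiPoint_mem_epi hv.1, fun η hη => ?_⟩
  have hc : Continuous fun z : WithLp 2 (E × ℝ) => z.fst := WithLp.continuous_fst 2 E ℝ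
  have h1 := (hc.tendsto (epiPoint f x)).eventually (hv.2 η hη)
  filter_upwards [nhdsWithin_le_nhds h1, self_mem_nhdsWithin] with z hz hzC
  have h2 : (((f x).toReal + inner ℝ v (z.fst - x) - η * ‖z.fst - x‖ : ℝ) : EReal) ≤ z.snd :=
    le_trans hz hzC
  have h3 := EReal.coe_le_coe_iff.1 h2
  have h4 : z - epiPoint f x = WithLp.toLp 2 (z.fst - x, z.snd - (f x).toReal) := rfl
  have h5 : ‖z.fst - x‖ ≤ ‖z - epiPoint f x‖ := norm_fst_le_withLp (z - epiPoint f x)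
  rw [h4, inner_withLp_prod, ← h4]
  nlinarith [mul_le_mul_of_nonneg_left h5 hη.le]

/-- If the subgradient inequality failed at `x'`, the point `(x', α x')` would lie in the epigraph.
There the normal inequality with a small enough tolerance yields `η‖x' - x‖ ≤ (η/2)‖x' - x‖`, hence
`x' = x`, where nothing can fail. -/
theorem mem_regSubdiff_of_regNormal_epi {f : E → EReal} {x v : E} (hx : FiniteAt f x)
    (hv : (WithLp.toLp 2 (v, (-1 : ℝ)) : WithLp 2 (E × ℝ)) ∈
      regNormal (epi f) (epiPoint f x)) : v ∈ regSubdiff f x := by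
  refine ⟨hx, fun η hη => ?_⟩
  -- A bound for how fast `x' ↦ (x', α x')` moves away from the epigraph point; the tolerance `η /
  -- (2 * c)` then costs only half of `η`.
  set c : ℝ := 1 + ‖v‖ + η with hc
  have hcpos : 0 < c := by positivity
  have h1 := eventually_nhdsWithin_iff.1 (hv.2 (η / (2 * c)) (by positivity))
  set α : E → ℝ := fun x' => (f x).toReal + inner ℝ v (x' - x) - η * ‖x' - x‖ with hα
  have hcont : Continuous fun x' : E => (WithLp.toLp 2 (x', α x') : WithLp 2 (E × ℝ)) :=
    continuous_withLp_mk continuous_id (by fun_prop)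
  have h2 : Tendsto (fun x' : E => (WithLp.toLp 2 (x', α x') : WithLp 2 (E × ℝ))) (𝓝 x)
      (𝓝 (epiPoint f x)) := by
    have := hcont.tendsto x
    simpa [hα, epiPoint] using this
  filter_upwards [h2.eventually h1] with x' hx'
  by_contra! hlt
  have h3 := hx' hlt.le
  have h4 : (WithLp.toLp 2 (x', α x') : WithLp 2 (E × ℝ)) - epiPoint f x =
    WithLp.toLp 2 (x' - x, α x' - (f x).toReal) := rfl
  have h5 : ‖(WithLp.toLp 2 (x', α x') : WithLp 2 (E × ℝ)) - epiPoint f x‖ ≤ c * ‖x' - x‖ := by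
    refine (norm_withLp_le _).trans ?_
    rw [h4]
    change ‖x' - x‖ + ‖α x' - (f x).toReal‖ ≤ _
    have h6 : ‖α x' - (f x).toReal‖ ≤ ‖v‖ * ‖x' - x‖ + η * ‖x' - x‖ := by
      rw [Real.norm_eq_abs, abs_le]
      have := abs_le.1 (abs_real_inner_le_norm v (x' - x))
      have : 0 ≤ η * ‖x' - x‖ := by positivity
      simp only [hα]
      constructor <;> linarith
    rw [hc]; linarith
  have h7 : η / (2 * c) * ‖(WithLp.toLp 2 (x', α x') : WithLp 2 (E × ℝ)) - epiPoint f x‖ ≤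
      η / 2 * ‖x' - x‖ := by
    refine (mul_le_mul_of_nonneg_left h5 (by positivity)).trans (le_of_eq ?_)
    field_simp
  have h8 := h3.trans h7
  rw [h4, inner_withLp_prod] at h8
  simp only [hα] at h8
  have h9 : ‖x' - x‖ ≤ 0 := by nlinarith
  have h10 : x' = x := sub_eq_zero.1 (norm_le_zero_iff.1 h9)
  subst h10
  simp [hx.coe_toReal] at hlt

theorem toLp_mem_limNormal_epi {f : E → EReal} {x v : E} (hv : v ∈ limSubdiff f x) :
    (WithLp.toLp 2 (v, (-1 : ℝ)) : WithLp 2 (E × ℝ)) ∈ limNormal (epi f) (epiPoint f x) := by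
  obtain ⟨hx, xs, vs, hxs, hf, hvs, hv⟩ := hv
  exact ⟨epiPoint_mem_epi hx, fun j => epiPoint f (xs j), fun j => WithLp.toLp 2 (vs j, -1),
    tendsto_epiPoint hx hxs hf, fun j => toLp_mem_regNormal_epi (hvs j),
    tendsto_withLp_mk hv tendsto_const_nhds⟩

/-- Both kinds of subgradient lift to normals of the same kind with last coordinate `-1`, and
regular normals of this form descend again. -/
theorem SubdiffRegularAt.limSubdiff_eq {f : E → EReal} {x : E} (h : SubdiffRegularAt f x) :
    limSubdiff f x = regSubdiff f x := by
  refine Subset.antisymm (fun v hv => ?_) (regSubdiff_subset_limSubdiff f x)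
  refine mem_regSubdiff_of_regNormal_epi h.1 ?_
  rw [← h.2.2.2]
  exact toLp_mem_limNormal_epi hv

theorem smul_mem_regNormal {C : Set E} {x v : E} {c : ℝ} (hc : 0 ≤ c) (hv : v ∈ regNormal C x) :
    c • v ∈ regNormal C x := by
  refine ⟨hv.1, fun η hη => ?_⟩
  filter_upwards [hv.2 (η / (c + 1)) (by positivity)] with x' hx'
  rw [real_inner_smul_left]
  refine (mul_le_mul_of_nonneg_left hx' hc).trans ?_
  have : c * (η / (c + 1)) ≤ η := by
    rw [mul_div_assoc', div_le_iff₀ (by positivity)]; nlinarith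
  rw [← mul_assoc]
  exact mul_le_mul_of_nonneg_right this (norm_nonneg _)

/-- Normals form a cone: scaling `(ys j, -1)` by `‖ys j‖⁻¹` makes the last coordinate vanish in the
limit. -/
theorem toLp_zero_mem_limNormal_epi {f : E → EReal} {x e : E} {xs ys : ℕ → E}
    (hx : FiniteAt f x) (hxs : Tendsto xs atTop (𝓝 x))
    (hf : Tendsto (fun j => f (xs j)) atTop (𝓝 (f x)))
    (hys : ∀ j, ys j ∈ regSubdiff f (xs j)) (hy : Tendsto (fun j => ‖ys j‖) atTop atTop)
    (he : Tendsto (fun j => ‖ys j‖⁻¹ • ys j) atTop (𝓝 e)) :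
    (WithLp.toLp 2 (e, (0 : ℝ)) : WithLp 2 (E × ℝ)) ∈ limNormal (epi f) (epiPoint f x) := by
  refine ⟨epiPoint_mem_epi hx, fun j => epiPoint f (xs j),
    fun j => ‖ys j‖⁻¹ • WithLp.toLp 2 (ys j, -1), tendsto_epiPoint hx hxs hf,
    fun j => smul_mem_regNormal (by positivity) (toLp_mem_regNormal_epi (hys j)), ?_⟩
  have h : Tendsto (fun j => ‖ys j‖⁻¹ * (-1)) atTop (𝓝 0) := by
    simpa using (tendsto_inv_atTop_zero.comp hy).mul_const (-1)
  exact tendsto_withLp_mk he h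

theorem regNormal_inner_deriv_nonpos {C : Set E} {w γ' : E} {γ : ℝ → E}
    (hw : w ∈ regNormal C (γ 0)) (hγ : HasDerivAt γ γ' 0) (hC : ∀ᶠ t in 𝓝 (0 : ℝ), γ t ∈ C) :
    inner ℝ w γ' ≤ 0 := by
  have hs : Tendsto (fun t : ℝ => t⁻¹ • (γ (0 + t) - γ 0)) (𝓝[>] 0) (𝓝 γ') :=
    hγ.tendsto_slope_zero_right
  have key : ∀ η : ℝ, 0 < η → inner ℝ w γ' ≤ η * ‖γ'‖ := by
    intro η hη
    have hγt : Tendsto γ (𝓝 0) (𝓝[C] (γ 0)) :=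
      tendsto_nhdsWithin_iff.2 ⟨hγ.continuousAt, hC⟩
    have h1 := nhdsWithin_le_nhds (s := Ioi 0) (hγt.eventually (hw.2 η hη))
    refine le_of_tendsto_of_tendsto (tendsto_const_nhds.inner hs) (hs.norm.const_mul η) ?_
    filter_upwards [h1, self_mem_nhdsWithin] with t ht htpos
    have htpos : (0 : ℝ) < t := htpos
    rw [zero_add, real_inner_smul_right, norm_smul, Real.norm_of_nonneg (by positivity)]
    have := mul_le_mul_of_nonneg_left ht (inv_nonneg.2 htpos.le)
    linarith
  by_contra! hpos
  have h0 : 0 < ‖γ'‖ := by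
    rw [norm_pos_iff]; rintro rfl; simp at hpos
  -- This tolerance gives `inner ℝ w γ' ≤ inner ℝ w γ' / 2`, against positivity.
  have := key (inner ℝ w γ' / (2 * ‖γ'‖)) (by positivity)
  rw [div_mul_eq_mul_div, le_div_iff₀ (by positivity)] at this
  nlinarith

/-- Each direction `h` may be reversed inside the parameter space, so the one-sided inequality along
lines becomes an equality. -/
theorem regNormal_inner_fderiv_eq_zero {F : Type*} [NormedAddCommGroup F] [NormedSpace ℝ F]
    {C : Set E} {w : E} {γ : F → E} {γ' : F →L[ℝ] E} {u : F}
    (hw : w ∈ regNormal C (γ u)) (hγ : HasFDerivAt γ γ' u) (hC : ∀ᶠ u' in 𝓝 u, γ u' ∈ C)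
    (h : F) : inner ℝ w (γ' h) = 0 := by
  have key : ∀ h : F, inner ℝ w (γ' h) ≤ 0 := by
    intro h
    have hl : HasDerivAt (fun t : ℝ => u + t • h) h 0 := by
      simpa using ((hasDerivAt_id (0 : ℝ)).smul_const h).const_add u
    have h0 : u + (0 : ℝ) • h = u := by simp
    refine regNormal_inner_deriv_nonpos (C := C) (γ := fun t : ℝ => γ (u + t • h)) ?_ ?_ ?_
    · simpa using hw
    · exact HasFDerivAt.comp_hasDerivAt (0 : ℝ) (by rw [h0]; exact hγ) hl
    · have := hl.continuousAt.tendsto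
      rw [h0] at this
      exact this.eventually hC
  refine le_antisymm (key h) ?_
  have := key (-h)
  rw [map_neg, inner_neg_right] at this
  linarith

theorem mem_regSubdiff_of_quadratic_bound {f : E → EReal} {x y : E} (c : ℝ) (hx : FiniteAt f x)
    (h : ∀ᶠ x' in 𝓝 x,
      (((f x).toReal + inner ℝ y (x' - x) - c * ‖x' - x‖ ^ 2 : ℝ) : EReal) ≤ f x') :
    y ∈ regSubdiff f x := by
  refine ⟨hx, fun η hη => ?_⟩
  have h1 : ∀ᶠ x' in 𝓝 x, c * ‖x' - x‖ < η := by
    have : Tendsto (fun x' : E => c * ‖x' - x‖) (𝓝 x) (𝓝 (c * ‖x - x‖)) :=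
      Continuous.tendsto (by fun_prop) x
    exact this.eventually_lt_const (by simpa using hη)
  filter_upwards [h, h1] with x' h2 h3
  refine le_trans (EReal.coe_le_coe_iff.2 ?_) h2
  nlinarith [norm_nonneg (x' - x)]

end Variational

/-! ### Subgradients from minimization on a slice, by quadratic penalty -/

section Penalty

theorem lowerSemicontinuous_add_coe {X : Type*} [TopologicalSpace X] {f : X → EReal}
    (hf : LowerSemicontinuous f) {c : X → ℝ}
    (hc : Continuous c) : LowerSemicontinuous fun x => f x + (c x : EReal) :=
  hf.add' (continuous_coe_real_ereal.comp hc).lowerSemicontinuous fun _ =>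
    EReal.continuousAt_add (Or.inr (EReal.coe_ne_bot _)) (Or.inr (EReal.coe_ne_top _))

theorem coe_le_of_add_le_add {a b c c' : ℝ} {z : EReal} (h : (a : EReal) + c ≤ z + c')
    (hb : b ≤ a + c - c') : (b : EReal) ≤ z := by
  induction z using EReal.rec with
  | bot => simp [← EReal.coe_add] at h
  | top => exact le_top
  | coe z =>
    norm_cast at h ⊢
    linarith

variable {E : Type*} [NormedAddCommGroup E] [InnerProductSpace ℝ E]

/-- Quadratic penalty for leaving `x₀ + K`, with a proximal term and a linear perturbation. -/
def penalty (K : Submodule ℝ E) [Kᗮ.HasOrthogonalProjection] (x₀ g : E) (t : ℝ) (x : E) : ℝ :=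
  t * ‖Kᗮ.starProjection (x - x₀)‖ ^ 2 + ‖x - x₀‖ ^ 2 - inner ℝ g (x - x₀)

theorem continuous_penalty (K : Submodule ℝ E) [Kᗮ.HasOrthogonalProjection] (x₀ g : E) (t : ℝ) :
    Continuous (penalty K x₀ g t) := by
  unfold penalty
  fun_prop

theorem penalty_self (K : Submodule ℝ E) [Kᗮ.HasOrthogonalProjection] (x₀ g : E) (t : ℝ) :
    penalty K x₀ g t x₀ = 0 := by
  simp [penalty]

/-- Fermat's rule: the vector is minus the gradient of the quadratic penalty at `x`. The
second-order remainder is at most `(t + 1)‖x' - x‖ ^ 2`, since an orthogonal projection does not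
increase norms. -/
theorem mem_regSubdiff_of_penalty_min {f : E → EReal} {K : Submodule ℝ E}
    [Kᗮ.HasOrthogonalProjection] {x₀ g x : E} {t : ℝ} (ht : 0 ≤ t) (hx : FiniteAt f x)
    (h : ∀ᶠ x' in 𝓝 x,
      f x + (penalty K x₀ g t x : EReal) ≤ f x' + (penalty K x₀ g t x' : EReal)) :
    g - (2 * t) • Kᗮ.starProjection (x - x₀) - (2 : ℝ) • (x - x₀) ∈ regSubdiff f x := by
  refine mem_regSubdiff_of_quadratic_bound (t + 1) hx ?_
  filter_upwards [h] with x' hx'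
  rw [← hx.coe_toReal] at hx'
  refine coe_le_of_add_le_add hx' ?_
  obtain ⟨d, rfl⟩ : ∃ d, x' = x + d := ⟨x' - x, by abel⟩
  have e1 : x + d - x₀ = (x - x₀) + d := by abel
  set a := x - x₀
  set Q := Kᗮ.starProjection
  have h1 : inner ℝ (Q a) (Q d) = inner ℝ (Q a) d := by
    rw [← Submodule.inner_starProjection_left_eq_right,
      Submodule.starProjection_eq_self_iff.2 (Submodule.starProjection_apply_mem _ _)]
  have h2 : ‖Q d‖ ^ 2 ≤ ‖d‖ ^ 2 :=
    pow_le_pow_left₀ (norm_nonneg _) (Submodule.norm_starProjection_apply_le _ _) 2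
  have h3 := mul_le_mul_of_nonneg_left h2 ht
  simp only [penalty, e1, map_add, inner_sub_left, inner_add_right, real_inner_smul_left,
    add_sub_cancel_left, norm_add_sq_real]
  change _ ≤ (f x).toReal + (t * ‖Q a‖ ^ 2 + ‖a‖ ^ 2 - inner ℝ g a) - _
  rw [h1]
  linarith

variable [FiniteDimensional ℝ E]

/-- The points `xs j` minimize `f + penalty` with parameter `j` over a ball around `x₀`; some of
them approach `x₀` together with their values. -/
theorem exists_penalty_sequence {f : E → EReal} (hf : LowerSemicontinuous f)
    (hbot : ∀ x, f x ≠ ⊥) (K : Submodule ℝ E) {x₀ g : E} (hx₀ : FiniteAt f x₀) {r : ℝ}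
    (hr : 0 < r)
    (hmin : ∀ z ∈ K, ‖z‖ ≤ r → (((f x₀).toReal + inner ℝ g z : ℝ) : EReal) ≤ f (x₀ + z)) :
    ∃ (ts : ℕ → ℝ) (xs : ℕ → E), Tendsto xs atTop (𝓝 x₀) ∧
      Tendsto (fun j => f (xs j)) atTop (𝓝 (f x₀)) ∧
      ∀ j, g - (2 * ts j) • Kᗮ.starProjection (xs j - x₀) - (2 : ℝ) • (xs j - x₀) ∈
        regSubdiff f (xs j) := by
  have hB : IsCompact (Metric.closedBall x₀ r) := isCompact_closedBall x₀ r
  have hx₀B : x₀ ∈ Metric.closedBall x₀ r := Metric.mem_closedBall_self hr.le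
  set F := (f x₀).toReal with hF
  have hFc : f x₀ = (F : EReal) := hx₀.coe_toReal.symm
  have hex : ∀ j : ℕ, ∃ x ∈ Metric.closedBall x₀ r, ∀ x' ∈ Metric.closedBall x₀ r,
      f x + (penalty K x₀ g j x : EReal) ≤ f x' + (penalty K x₀ g j x' : EReal) := fun j =>
    ((lowerSemicontinuous_add_coe hf
      (continuous_penalty K x₀ g j)).lowerSemicontinuousOn _).exists_isMinOn ⟨x₀, hx₀B⟩ hB
  choose xs hxsB hxs using hex
  -- The minimum of `f` on the ball bounds `f (xs j)` below uniformly in `j`, so the penalty term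
  -- stays bounded and the component of `xs j - x₀` in `Kᗮ` tends to zero.
  obtain ⟨z₀, -, hz₀⟩ := (hf.lowerSemicontinuousOn _).exists_isMinOn ⟨x₀, hx₀B⟩ hB
  have hz₀top : f z₀ ≠ ⊤ := fun h => hx₀.1 (top_le_iff.1 (h ▸ hz₀ hx₀B))
  have hfin : ∀ j, FiniteAt f (xs j) := fun j => by
    refine ⟨fun h => ?_, hbot _⟩
    have := hxs j x₀ hx₀B
    rw [h, penalty_self, hFc, EReal.top_add_coe, ← EReal.coe_add] at this
    exact EReal.coe_ne_top _ (top_le_iff.1 this)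
  have hle : ∀ j, (f (xs j)).toReal + penalty K x₀ g j (xs j) ≤ F := fun j => by
    have := hxs j x₀ hx₀B
    rw [penalty_self, hFc, ← (hfin j).coe_toReal] at this
    norm_cast at this
    simpa using this
  have hlow : ∀ j, (f z₀).toReal ≤ (f (xs j)).toReal := fun j =>
    EReal.toReal_le_toReal (hz₀ (hxsB j)) (hbot _) (hfin j).1
  have hxr : ∀ j, ‖xs j - x₀‖ ≤ r := fun j => by simpa [dist_eq_norm] using hxsB j
  have hgr : ∀ j, inner ℝ g (xs j - x₀) ≤ ‖g‖ * r := fun j =>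
    (real_inner_le_norm _ _).trans (mul_le_mul_of_nonneg_left (hxr j) (norm_nonneg _))
  obtain ⟨x', -, φ, hφ, hlim⟩ := hB.tendsto_subseq hxsB
  set Q := Kᗮ.starProjection with hQ
  set c : ℝ := F - (f z₀).toReal + ‖g‖ * r with hc
  have hQbd : ∀ j : ℕ, (j : ℝ) * ‖Q (xs j - x₀)‖ ^ 2 ≤ c := fun j => by
    have h1 := hle j
    have h2 := hlow j
    have h3 := hgr j
    have h4 : 0 ≤ ‖xs j - x₀‖ ^ 2 := by positivity
    simp only [penalty] at h1
    rw [← hQ] at h1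
    linarith
  have hQlim : Q (x' - x₀) = 0 := by
    have h1 : Tendsto (fun j => ‖Q (xs (φ j) - x₀)‖ ^ 2) atTop (𝓝 (‖Q (x' - x₀)‖ ^ 2)) :=
      (((Q.continuous.tendsto _).comp (hlim.sub_const x₀)).norm).pow 2
    have h2 : Tendsto (fun j => c / (φ j : ℝ)) atTop (𝓝 0) :=
      (tendsto_const_div_atTop_nhds_zero_nat c).comp hφ.tendsto_atTop
    have h3 : ‖Q (x' - x₀)‖ ^ 2 ≤ 0 := by
      refine le_of_tendsto_of_tendsto h1 h2 ?_
      filter_upwards [hφ.tendsto_atTop.eventually_gt_atTop 0] with j hj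
      rw [le_div_iff₀ (by exact_mod_cast hj), mul_comm]
      exact hQbd (φ j)
    exact norm_eq_zero.1 (pow_eq_zero_iff two_ne_zero |>.1 (le_antisymm h3 (by positivity)))
  have hzK : x' - x₀ ∈ K := by
    have := (Submodule.starProjection_apply_eq_zero_iff _).1 hQlim
    rwa [Submodule.orthogonal_orthogonal] at this
  have hup : ∀ j, (f (xs j)).toReal ≤ F + inner ℝ g (xs j - x₀) - ‖xs j - x₀‖ ^ 2 := fun j => by
    have h1 := hle j
    have h4 : 0 ≤ (j : ℝ) * ‖Q (xs j - x₀)‖ ^ 2 := by positivity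
    simp only [penalty] at h1
    rw [← hQ] at h1
    linarith
  have hupc : Tendsto (fun j => F + inner ℝ g (xs (φ j) - x₀) - ‖xs (φ j) - x₀‖ ^ 2) atTop
      (𝓝 (F + inner ℝ g (x' - x₀) - ‖x' - x₀‖ ^ 2)) := by
    have : Continuous fun y : E => F + inner ℝ g (y - x₀) - ‖y - x₀‖ ^ 2 := by fun_prop
    exact (this.tendsto x').comp hlim
  have hupE : ∀ j, f (xs (φ j)) ≤
      ((F + inner ℝ g (xs (φ j) - x₀) - ‖xs (φ j) - x₀‖ ^ 2 : ℝ) : EReal) := fun j => by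
    rw [← (hfin _).coe_toReal]
    exact EReal.coe_le_coe_iff.2 (hup _)
  have hx'r : ‖x' - x₀‖ ≤ r := le_of_tendsto (hlim.sub_const x₀).norm (.of_forall fun j => hxr _)
  -- On the slice `f` is bounded below by its linear minorant at `x₀`, while lower semicontinuity
  -- bounds `f x'` above by the same expression minus `‖x' - x₀‖ ^ 2`. The proximal term thus forces
  -- the limit to be `x₀`.
  have hx' : x' = x₀ := by
    have h1 := hmin _ hzK hx'r
    have h2 : f (x₀ + (x' - x₀)) ≤
        ((F + inner ℝ g (x' - x₀) - ‖x' - x₀‖ ^ 2 : ℝ) : EReal) := by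
      rw [add_sub_cancel]
      refine le_of_forall_lt fun y hy => ?_
      by_contra! hcon
      obtain ⟨y', hy1, hy2⟩ := exists_between hy
      have h3 := hlim.eventually (hf x' y' hy2)
      have h4 := (continuous_coe_real_ereal.tendsto _).comp hupc
      have h5 : y' ≤ ((F + inner ℝ g (x' - x₀) - ‖x' - x₀‖ ^ 2 : ℝ) : EReal) := by
        refine ge_of_tendsto h4 ?_
        filter_upwards [h3] with j hj
        exact hj.le.trans (hupE j)
      exact absurd (h5.trans hcon) (not_le.2 hy1)
    have h3 := EReal.coe_le_coe_iff.1 (h1.trans h2)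
    have h4 : ‖x' - x₀‖ ^ 2 = 0 := le_antisymm (by linarith) (by positivity)
    exact sub_eq_zero.1 (norm_eq_zero.1 (pow_eq_zero_iff two_ne_zero |>.1 h4))
  subst hx'
  have hflim : Tendsto (fun j => f (xs (φ j))) atTop (𝓝 (f x')) := by
    refine tendsto_order.2 ⟨fun y hy => hlim.eventually (hf x' y hy), fun y hy => ?_⟩
    have h4 := (continuous_coe_real_ereal.tendsto _).comp hupc
    simp only [sub_self, inner_zero_right, norm_zero, add_zero] at h4
    norm_num at h4
    rw [← hFc] at h4
    filter_upwards [h4.eventually_lt_const hy] with j hj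
    exact (hupE j).trans_lt hj
  have hint : ∀ᶠ j in atTop, xs (φ j) ∈ Metric.ball x' r :=
    hlim.eventually (Metric.ball_mem_nhds _ hr)
  -- Discarding finitely many terms puts all points inside the open ball, where minimizers over the
  -- closed ball are local minimizers.
  obtain ⟨N, hN⟩ := eventually_atTop.1 hint
  refine ⟨fun j => (φ (j + N) : ℝ), fun j => xs (φ (j + N)), hlim.comp (tendsto_add_atTop_nat N),
    hflim.comp (tendsto_add_atTop_nat N), fun j => ?_⟩
  refine mem_regSubdiff_of_penalty_min (by positivity) (hfin _) ?_
  filter_upwards [Metric.isOpen_ball.mem_nhds (hN (j + N) (by omega))] with y hy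
  exact hxs _ y (Metric.ball_subset_closedBall hy)

/-- If `x₀` minimizes `f - ⟪g, ·⟫` locally in `x₀ + K`, then `f` has a subgradient at `x₀` with the
same projection onto `K` as `g`, unless the epigraph has a horizontal normal orthogonal to `K`. -/
theorem exists_limSubdiff_or_horizontal_normal {f : E → EReal} (hf : LowerSemicontinuous f)
    (hbot : ∀ x, f x ≠ ⊥) (K : Submodule ℝ E) {x₀ g : E} (hx₀ : FiniteAt f x₀) {r : ℝ}
    (hr : 0 < r)
    (hmin : ∀ z ∈ K, ‖z‖ ≤ r → (((f x₀).toReal + inner ℝ g z : ℝ) : EReal) ≤ f (x₀ + z)) :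
    (∃ y ∈ limSubdiff f x₀, K.starProjection y = K.starProjection g) ∨
      ∃ e ∈ Kᗮ, ‖e‖ = 1 ∧
        (WithLp.toLp 2 (e, (0 : ℝ)) : WithLp 2 (E × ℝ)) ∈ limNormal (epi f) (epiPoint f x₀) := by
  obtain ⟨ts, xs, hxs, hfxs, hreg⟩ := exists_penalty_sequence hf hbot K hx₀ hr hmin
  set ys : ℕ → E := fun j =>
    g - (2 * ts j) • Kᗮ.starProjection (xs j - x₀) - (2 : ℝ) • (xs j - x₀) with hys
  -- The penalty pushes only in `Kᗮ`, so the `K`-components converge even if the subgradients are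
  -- unbounded.
  have hP : ∀ j, K.starProjection (ys j) =
      K.starProjection g - (2 : ℝ) • K.starProjection (xs j - x₀) := fun j => by
    have h0 : K.starProjection (Kᗮ.starProjection (xs j - x₀)) = 0 :=
      (Submodule.starProjection_apply_eq_zero_iff _).2 (Submodule.starProjection_apply_mem _ _)
    simp only [hys, map_sub, map_smul] at h0 ⊢
    rw [h0, smul_zero, sub_zero]
  have hPlim : Tendsto (fun j => K.starProjection (ys j)) atTop (𝓝 (K.starProjection g)) := by
    simp only [hP]
    have : Continuous fun x : E => K.starProjection g - (2 : ℝ) • K.starProjection (x - x₀) := by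
      fun_prop
    have h := (this.tendsto x₀).comp hxs
    rwa [sub_self, map_zero, smul_zero, sub_zero] at h
  by_cases hbd : Tendsto (fun j => ‖ys j‖) atTop atTop
  · right
    have hb : ∀ j, ‖ys j‖⁻¹ • ys j ∈ Metric.closedBall (0 : E) 1 := fun j => by
      rw [mem_closedBall_zero_iff, norm_smul, norm_inv, norm_norm]
      exact inv_mul_le_one
    obtain ⟨e, -, φ, hφ, he⟩ := (isCompact_closedBall (0 : E) 1).tendsto_subseq hb
    have hbdφ := hbd.comp hφ.tendsto_atTop
    refine ⟨e, ?_, ?_, toLp_zero_mem_limNormal_epi hx₀ (hxs.comp hφ.tendsto_atTop)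
      (hfxs.comp hφ.tendsto_atTop) (fun j => hreg (φ j)) hbdφ he⟩
    -- Convergent `K`-components divided by norms tending to infinity leave nothing of `e` in `K`.
    · rw [← Submodule.starProjection_apply_eq_zero_iff]
      have h1 := (K.starProjection.continuous.tendsto e).comp he
      have h2 := (tendsto_inv_atTop_zero.comp hbdφ).smul (hPlim.comp hφ.tendsto_atTop)
      rw [zero_smul] at h2
      refine tendsto_nhds_unique h1 (h2.congr fun j => ?_)
      simp [map_smul]
    · refine tendsto_nhds_unique he.norm (tendsto_const_nhds.congr' ?_)
      filter_upwards [hbdφ.eventually_gt_atTop 0] with j hj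
      have hj : 0 < ‖ys (φ j)‖ := hj
      simp [norm_smul, hj.ne']
  · left
    obtain ⟨R, hR⟩ : ∃ R, ∃ᶠ j in atTop, ys j ∈ Metric.closedBall (0 : E) R := by
      rw [tendsto_atTop] at hbd
      push Not at hbd
      obtain ⟨R, hR⟩ := hbd
      refine ⟨R, hR.mono fun j hj => ?_⟩
      rw [mem_closedBall_zero_iff]
      exact hj.le
    obtain ⟨y, -, φ, hφ, hy⟩ := tendsto_subseq_of_frequently_bounded Metric.isBounded_closedBall hR
    refine ⟨y, ⟨hx₀, fun j => xs (φ j), fun j => ys (φ j), hxs.comp hφ.tendsto_atTop,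
      hfxs.comp hφ.tendsto_atTop, fun j => hreg _, hy⟩, ?_⟩
    exact tendsto_nhds_unique ((K.starProjection.continuous.tendsto y).comp hy)
      (hPlim.comp hφ.tendsto_atTop)

end Penalty

/-! ### Graphs tangent to the orthogonal complement of a subspace -/

section Graph

variable {E F : Type*} [NormedAddCommGroup E] [InnerProductSpace ℝ E]
  [NormedAddCommGroup F] [NormedSpace ℝ F]

/-- The normals of the epigraph annihilate the velocities of the graph of `f` over a curve along
which `f` is smooth. -/
theorem inner_fderiv_add_eq_zero_of_regNormal_epi {f : E → EReal} {X : F → E} {φ : F → ℝ}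
    {X' : F →L[ℝ] E} {φ' : F →L[ℝ] ℝ} {u : F} {a : E} {β : ℝ}
    (hw : (WithLp.toLp 2 (a, β) : WithLp 2 (E × ℝ)) ∈ regNormal (epi f) (epiPoint f (X u)))
    (hX : HasFDerivAt X X' u) (hφ : HasFDerivAt φ φ' u)
    (hf : ∀ᶠ u' in 𝓝 u, f (X u') = (φ u' : EReal)) (h : F) :
    inner ℝ a (X' h) + β * φ' h = 0 := by
  set T := (WithLp.prodContinuousLinearEquiv 2 ℝ E ℝ).symm
  have hγ : HasFDerivAt (fun u => T (X u, φ u)) ((T : E × ℝ →L[ℝ] _) ∘L X'.prod φ') u :=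
    T.hasFDerivAt.comp u (hX.prodMk hφ)
  have h0 : epiPoint f (X u) = T (X u, φ u) := by
    rw [epiPoint, hf.self_of_nhds, EReal.toReal_coe]
    rfl
  rw [h0] at hw
  have key := regNormal_inner_fderiv_eq_zero (γ := fun u => T (X u, φ u)) hw hγ
    (hf.mono fun u' hu' => hu'.le) h
  rw [← key]
  exact (inner_withLp_prod a (X' h) β (φ' h)).symm

/-- Near `u = 0`, the map `u ↦ x₀ + A u + b u` parametrizes a `C^1` graph over `Kᗮ` that is tangent
to `Kᗮ` at `x₀`; the map `π` reads off the parameter. -/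
structure IsTangentGraph (K : Submodule ℝ E) [Kᗮ.HasOrthogonalProjection]
    (A : F →L[ℝ] E) (π : E →L[ℝ] F) (b : F → E) : Prop where
  apply_mem : ∀ u, A u ∈ Kᗮ
  apply_coord : ∀ x, A (π x) = Kᗮ.starProjection x
  coord_apply : ∀ u, π (A u) = u
  mem : ∀ u, b u ∈ K
  zero : b 0 = 0
  differentiableAt : ∀ᶠ u in 𝓝 0, DifferentiableAt ℝ b u
  continuousAt_fderiv : ContinuousAt (fderiv ℝ b) 0
  fderiv_zero : fderiv ℝ b 0 = 0

namespace IsTangentGraph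

variable {K : Submodule ℝ E} {A : F →L[ℝ] E} {π : E →L[ℝ] F} {b : F → E}

theorem hasFDerivAt_param (x₀ : E) {u : F} (hb : DifferentiableAt ℝ b u) :
    HasFDerivAt (fun u => x₀ + A u + b u) (A + fderiv ℝ b u) u :=
  (A.hasFDerivAt.const_add x₀).add hb.hasFDerivAt

theorem tendsto_coord {x₀ : E} {xs : ℕ → E} (hxs : Tendsto xs atTop (𝓝 x₀)) :
    Tendsto (fun j => π (xs j - x₀)) atTop (𝓝 0) := by
  have h := (π.continuous.tendsto _).comp (hxs.sub_const x₀)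
  rwa [sub_self, map_zero] at h

variable [FiniteDimensional ℝ E]

theorem coord_eq_zero (hG : IsTangentGraph K A π b) {x : E} (hx : x ∈ K) : π x = 0 := by
  have h1 : A (π x) = 0 := by
    rw [hG.apply_coord, Submodule.starProjection_apply_eq_zero_iff, Submodule.orthogonal_orthogonal]
    exact hx
  rw [← hG.coord_apply (π x), h1, map_zero]

theorem coord_sub (hG : IsTangentGraph K A π b) (x₀ : E) (u : F) :
    π (x₀ + A u + b u - x₀) = u := by
  rw [show x₀ + A u + b u - x₀ = A u + b u by abel, map_add, hG.coord_apply,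
    hG.coord_eq_zero (hG.mem u), add_zero]

theorem fderiv_mem (hG : IsTangentGraph K A π b) {u : F} (hb : DifferentiableAt ℝ b u) (h : F) :
    fderiv ℝ b u h ∈ K := by
  have h1 : HasFDerivAt (fun u => Kᗮ.starProjection (b u))
      (Kᗮ.starProjection ∘L fderiv ℝ b u) u :=
    Kᗮ.starProjection.hasFDerivAt.comp u hb.hasFDerivAt
  have h2 : (fun u => Kᗮ.starProjection (b u)) = fun _ => 0 := by
    funext u
    rw [Submodule.starProjection_apply_eq_zero_iff, Submodule.orthogonal_orthogonal]
    exact hG.mem u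
  rw [h2] at h1
  have h3 := DFunLike.congr_fun (h1.unique (hasFDerivAt_const (0 : E) u)) h
  have h4 : Kᗮ.starProjection (fderiv ℝ b u h) = 0 := h3
  rwa [Submodule.starProjection_apply_eq_zero_iff, Submodule.orthogonal_orthogonal] at h4

/-- The normal cone at `x₀` of the graph is `K`. -/
theorem limNormal_eq (hG : IsTangentGraph K A π b) {x₀ : E} {δ : ℝ} (hδ : 0 < δ) {M : Set E}
    (hM : M = {x | ∃ u, ‖A u‖ ≤ δ ∧ x = x₀ + A u + b u}) : limNormal M x₀ = (K : Set E) := by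
  have hx₀ : x₀ ∈ M := by
    rw [hM]
    exact ⟨0, by simpa using hδ.le, by simp [hG.zero]⟩
  have hcoord : ∀ x ∈ M, x = x₀ + A (π (x - x₀)) + b (π (x - x₀)) := by
    intro x hx
    rw [hM] at hx
    obtain ⟨u, -, rfl⟩ := hx
    rw [hG.coord_sub]
  have hnear : ∀ᶠ u in 𝓝 (0 : F), ‖A u‖ < δ := by
    have : Tendsto (fun u => ‖A u‖) (𝓝 0) (𝓝 ‖A 0‖) := A.continuous.norm.tendsto 0
    exact this.eventually_lt_const (by simpa using hδ)
  refine Subset.antisymm (fun w hw => ?_) (fun w hw => ?_)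
  · obtain ⟨-, xs, ws, hxs, hws, hw⟩ := hw
    have hu := tendsto_coord (π := π) hxs
    -- Regular normals at nearby points annihilate the tangent vectors `A h + fderiv ℝ b u h`. These
    -- tend to `A h`, and the vectors `A h` fill `Kᗮ`.
    rw [← Submodule.orthogonal_orthogonal K, SetLike.mem_coe, Submodule.mem_orthogonal']
    intro z hz
    obtain ⟨h, rfl⟩ : ∃ h, A h = z :=
      ⟨π z, by rw [hG.apply_coord, Submodule.starProjection_eq_self_iff.2 hz]⟩
    have h1 : Tendsto (fun j => inner ℝ (ws j) (A h + fderiv ℝ b (π (xs j - x₀)) h)) atTop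
        (𝓝 (inner ℝ w (A h))) := by
      have h2 : Tendsto (fun j => fderiv ℝ b (π (xs j - x₀)) h) atTop (𝓝 0) := by
        have h3 : Tendsto (fun j => fderiv ℝ b (π (xs j - x₀))) atTop (𝓝 0) := by
          rw [← hG.fderiv_zero]
          exact hG.continuousAt_fderiv.tendsto.comp hu
        have h4 := ((ContinuousLinearMap.apply ℝ E h).continuous.tendsto 0).comp h3
        rwa [map_zero] at h4
      simpa using hw.inner (h2.const_add (A h))
    refine tendsto_nhds_unique h1 (tendsto_const_nhds.congr' ?_)
    filter_upwards [hu.eventually hG.differentiableAt, hu.eventually hnear.eventually_nhds]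
      with j hj1 hj2
    have h3 := hws j
    rw [hcoord _ h3.1] at h3
    refine (regNormal_inner_fderiv_eq_zero (γ := fun u => x₀ + A u + b u) h3
      (hasFDerivAt_param x₀ hj1) ?_ h).symm
    filter_upwards [hj2] with u hu
    rw [hM]
    exact ⟨u, hu.le, rfl⟩
  -- A vector of `K` is already a regular normal at `x₀`: it sees only the `b`-part of the graph,
  -- which is `o(u)` by tangency.
  · refine ⟨hx₀, fun _ => x₀, fun _ => w, tendsto_const_nhds, fun _ => ⟨hx₀, fun η hη => ?_⟩,
      tendsto_const_nhds⟩
    have h1 : (fun u => b u) =o[𝓝 0] fun u => u := by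
      have := hG.differentiableAt.self_of_nhds.hasFDerivAt
      rw [hG.fderiv_zero, hasFDerivAt_iff_isLittleO_nhds_zero] at this
      simpa [hG.zero] using this
    have h2 : ∀ᶠ u in 𝓝 (0 : F), ‖b u‖ ≤ η / ((‖w‖ + 1) * (‖π‖ + 1)) * ‖u‖ :=
      h1.bound (by positivity)
    have hu : Tendsto (fun x => π (x - x₀)) (𝓝[M] x₀) (𝓝 0) := by
      have : Continuous fun x => π (x - x₀) := by fun_prop
      simpa using (this.tendsto x₀).mono_left nhdsWithin_le_nhds
    filter_upwards [hu.eventually h2, self_mem_nhdsWithin] with x hx hxM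
    have h3 : inner ℝ w (x - x₀) = inner ℝ w (b (π (x - x₀))) := by
      conv_lhs => rw [hcoord x hxM]
      rw [show ∀ a c : E, x₀ + a + c - x₀ = a + c by intros; abel, inner_add_right,
        Submodule.inner_right_of_mem_orthogonal hw (hG.apply_mem _), zero_add]
    rw [h3]
    calc inner ℝ w (b (π (x - x₀))) ≤ ‖w‖ * ‖b (π (x - x₀))‖ := real_inner_le_norm _ _
      _ ≤ (‖w‖ + 1) * (η / ((‖w‖ + 1) * (‖π‖ + 1)) * ((‖π‖ + 1) * ‖x - x₀‖)) := by
          have h4 : ‖π (x - x₀)‖ ≤ (‖π‖ + 1) * ‖x - x₀‖ :=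
            (π.le_opNorm _).trans (by gcongr; linarith)
          gcongr
          · linarith
          · exact hx.trans (by gcongr)
      _ = η * ‖x - x₀‖ := by field_simp

/-- Where `f` is smooth along the graph, the component in `Kᗮ` of a regular subgradient is controlled
by its component in `K` and the derivatives. -/
theorem norm_starProjection_orthogonal_le (hG : IsTangentGraph K A π b) {f : E → EReal} {x₀ y : E}
    {φ : F → ℝ} {u : F} (hb : DifferentiableAt ℝ b u) (hφ : DifferentiableAt ℝ φ u)
    (hf : ∀ᶠ u' in 𝓝 u, f (x₀ + A u' + b u') = (φ u' : EReal))
    (hy : y ∈ regSubdiff f (x₀ + A u + b u)) :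
    ‖Kᗮ.starProjection y‖ ≤
      (‖fderiv ℝ φ u‖ + ‖K.starProjection y‖ * ‖fderiv ℝ b u‖) * ‖π‖ := by
  set q := Kᗮ.starProjection y with hq
  -- The velocity in direction `π y` has `Kᗮ`-part `q`, so this identity expresses `‖q‖ ^ 2` through
  -- the two derivatives; dividing by `‖q‖` gives the bound.
  have h1 := inner_fderiv_add_eq_zero_of_regNormal_epi (X := fun u => x₀ + A u + b u)
    (toLp_mem_regNormal_epi hy) (hasFDerivAt_param x₀ hb) hφ.hasFDerivAt hf (π y)
  rw [_root_.add_apply, hG.apply_coord, ← hq, inner_add_right] at h1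
  have h2 : inner ℝ y q = ‖q‖ ^ 2 := by
    rw [← real_inner_self_eq_norm_sq, ← sub_eq_zero, ← inner_sub_left]
    exact Submodule.starProjection_inner_eq_zero _ _ (Submodule.starProjection_apply_mem _ _)
  have h3 : π y = π q := by
    conv_lhs => rw [← K.starProjection_add_starProjection_orthogonal y]
    rw [map_add, hG.coord_eq_zero (Submodule.starProjection_apply_mem _ _), zero_add]
  have h4 : inner ℝ y (fderiv ℝ b u (π y)) =
      inner ℝ (K.starProjection y) (fderiv ℝ b u (π y)) := by
    rw [Submodule.inner_starProjection_left_eq_right,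
      Submodule.starProjection_eq_self_iff.2 (hG.fderiv_mem hb _)]
  have h5 : ‖π y‖ ≤ ‖π‖ * ‖q‖ := h3 ▸ π.le_opNorm q
  have h6 : fderiv ℝ φ u (π y) ≤ ‖fderiv ℝ φ u‖ * (‖π‖ * ‖q‖) :=
    (le_abs_self _).trans (((fderiv ℝ φ u).le_opNorm _).trans (by gcongr))
  have h7 : -inner ℝ (K.starProjection y) (fderiv ℝ b u (π y)) ≤
      ‖K.starProjection y‖ * (‖fderiv ℝ b u‖ * (‖π‖ * ‖q‖)) :=
    (neg_le_abs _).trans ((abs_real_inner_le_norm _ _).trans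
      (by gcongr; exact ((fderiv ℝ b u).le_opNorm _).trans (by gcongr)))
  rw [h2, h4] at h1
  rcases (norm_nonneg q).eq_or_lt with h0 | h0
  · rw [← h0]; positivity
  · refine le_of_mul_le_mul_right ?_ h0
    nlinarith

/-- Along a graph on which `f` is smooth, the epigraph has no horizontal normals in `Kᗮ`. -/
theorem eq_zero_of_horizontal_normal (hG : IsTangentGraph K A π b) {f : E → EReal} {x₀ e : E}
    {φ : F → ℝ} {u : F} (hb : DifferentiableAt ℝ b u) (hφ : DifferentiableAt ℝ φ u)
    (hf : ∀ᶠ u' in 𝓝 u, f (x₀ + A u' + b u') = (φ u' : EReal)) (he : e ∈ Kᗮ)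
    (hn : (WithLp.toLp 2 (e, (0 : ℝ)) : WithLp 2 (E × ℝ)) ∈
      regNormal (epi f) (epiPoint f (x₀ + A u + b u))) : e = 0 := by
  -- In direction `π e` the graph velocity is `e` plus a vector of `K`, and the last coordinate of
  -- the normal is `0`, so the identity reduces to `‖e‖ ^ 2 = 0`.
  have h1 := inner_fderiv_add_eq_zero_of_regNormal_epi (X := fun u => x₀ + A u + b u)
    hn (hasFDerivAt_param x₀ hb) hφ.hasFDerivAt hf (π e)
  rw [_root_.add_apply, hG.apply_coord, inner_add_right,
    Submodule.starProjection_eq_self_iff.2 he,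
    Submodule.inner_left_of_mem_orthogonal (hG.fderiv_mem hb _) he] at h1
  simpa using h1

end IsTangentGraph

/-- A `C^k` graph over `Kᗮ`, tangent to `Kᗮ`, is a `C^k` manifold. -/
theorem isManifoldAround_graph {m p : ℕ} {k : ℕ∞} {K : Submodule ℝ E}
    [FiniteDimensional ℝ E]
    {A : EuclideanSpace ℝ (Fin m) →L[ℝ] E} {π : E →L[ℝ] EuclideanSpace ℝ (Fin m)}
    {v : EuclideanSpace ℝ (Fin m) → EuclideanSpace ℝ (Fin p)}
    (B : EuclideanSpace ℝ (Fin p) →L[ℝ] E) (σ : E →L[ℝ] EuclideanSpace ℝ (Fin p))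
    (hG : IsTangentGraph K A π fun u => B (v u))
    (hσA : ∀ u, σ (A u) = 0) (hσB : ∀ w, σ (B w) = w)
    (hAB : ∀ x, A (π x) + B (σ x) = x) {x₀ : E} {δ η : ℝ} (hδ : 0 < δ) (hη : 0 < η)
    (hv : ContDiffOn ℝ k v {u | ‖A u‖ < η}) {M : Set E}
    (hM : M = {x | ∃ u, ‖A u‖ ≤ δ ∧ x = x₀ + A u + B (v u)}) :
    IsManifoldAround k M x₀ p := by
  have hv0 : v 0 = 0 := by rw [← hσB (v 0), hG.zero, map_zero]
  have hvd : HasFDerivAt v (0 : EuclideanSpace ℝ (Fin m) →L[ℝ] EuclideanSpace ℝ (Fin p)) 0 := by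
    have h1 := hG.differentiableAt.self_of_nhds.hasFDerivAt
    rw [hG.fderiv_zero] at h1
    have h2 := σ.hasFDerivAt.comp (0 : EuclideanSpace ℝ (Fin m)) h1
    rw [ContinuousLinearMap.comp_zero] at h2
    exact h2.congr_of_eventuallyEq (.of_forall fun u => (hσB (v u)).symm)
  have hQc : Continuous fun y => ‖A (π (y - x₀))‖ := by fun_prop
  -- The bound `η` keeps `v` smooth; `δ` ensures that zeros of the defining map `G` lie in `M`.
  -- Since `v` has zero derivative at `0`, the derivative of `G` at `x₀` is the surjection `σ`.
  set Q : Set E := {y | ‖A (π (y - x₀))‖ < min η δ} with hQ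
  set G : E → EuclideanSpace ℝ (Fin p) := fun y => σ (y - x₀) - v (π (y - x₀)) with hGdef
  have hGs : ContDiffOn ℝ k G Q := by
    refine ContDiffOn.sub (by fun_prop) (hv.comp (t := {u | ‖A u‖ < η}) (by fun_prop) ?_)
    intro y hy
    exact (show ‖A (π (y - x₀))‖ < min η δ from hy).trans_le (min_le_left _ _)
  have hGd : HasFDerivAt G σ x₀ := by
    have h1 : HasFDerivAt (fun y => y - x₀) (ContinuousLinearMap.id ℝ E) x₀ :=
      (hasFDerivAt_id x₀).sub_const x₀
    have h2 : HasFDerivAt (fun y => π (y - x₀)) π x₀ := π.hasFDerivAt.comp x₀ h1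
    have h3 : HasFDerivAt (fun y => v (π (y - x₀)))
        ((0 : EuclideanSpace ℝ (Fin m) →L[ℝ] EuclideanSpace ℝ (Fin p)) ∘L π) x₀ :=
      HasFDerivAt.comp x₀ (by simpa using hvd) h2
    have h4 : HasFDerivAt (fun y => σ (y - x₀)) σ x₀ := σ.hasFDerivAt.comp x₀ h1
    have h5 := h4.sub h3
    rwa [ContinuousLinearMap.zero_comp, sub_zero] at h5
  refine ⟨?_, Q, isOpen_lt hQc continuous_const, by simp [hQ, hη, hδ], fun i y => G y i, ?_, ?_, ?_⟩
  · rw [hM]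
    exact ⟨0, by simpa using hδ.le, by simp [hv0]⟩
  · intro i
    exact (EuclideanSpace.proj (𝕜 := ℝ) i).contDiff.comp_contDiffOn hGs
  · ext y
    constructor
    · rintro ⟨hyM, hyQ⟩
      refine ⟨hyQ, fun i => ?_⟩
      rw [hM] at hyM
      obtain ⟨u, -, rfl⟩ := hyM
      have h1 : x₀ + A u + B (v u) - x₀ = A u + B (v u) := by abel
      have h2 : G (x₀ + A u + B (v u)) = 0 := by
        simp only [hGdef]
        rw [hG.coord_sub, h1, map_add, hσA, hσB, zero_add, sub_self]
      change G _ i = 0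
      rw [h2]
      rfl
    · rintro ⟨hyQ, hy⟩
      refine ⟨?_, hyQ⟩
      have h1 : G y = 0 := by
        ext i
        exact hy i
      rw [hM]
      refine ⟨π (y - x₀), hyQ.le.trans (min_le_right _ _), ?_⟩
      rw [← sub_eq_zero.1 h1, add_assoc, hAB, add_sub_cancel]
  · have h1 : ∀ i, fderiv ℝ (fun y => G y i) x₀ = EuclideanSpace.proj (𝕜 := ℝ) i ∘L σ := fun i =>
      ((EuclideanSpace.proj (𝕜 := ℝ) i).hasFDerivAt.comp x₀ hGd).fderiv
    rw [Fintype.linearIndependent_iff]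
    intro c hc j
    have h2 := DFunLike.congr_fun hc (B (EuclideanSpace.single j 1))
    simp only [h1, _root_.sum_apply, _root_.smul_apply,
      ContinuousLinearMap.comp_apply, hσB, PiLp.proj_apply] at h2
    simpa [Pi.single_apply] using h2

/-- If `l` dominates `‖b‖` up to a quadratic term, with equality at `0`, then `b` and `l` are
stationary at `0`. -/
theorem hasFDerivAt_zero_of_norm_le {F' : Type*} [NormedAddCommGroup F'] [NormedSpace ℝ F']
    {A : F →L[ℝ] E} {b : F → F'} {l : F → ℝ} {κ c : ℝ} (hκ : 0 < κ) (hl : DifferentiableAt ℝ l 0)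
    (h : ∀ᶠ u in 𝓝 0, κ * ‖b u‖ ≤ l u - l 0 + c * ‖A u‖ ^ 2) (hb : b 0 = 0) :
    HasFDerivAt b (0 : F →L[ℝ] F') 0 ∧ HasFDerivAt l (0 : F →L[ℝ] ℝ) 0 := by
  have hq : HasFDerivAt (fun u => c * ‖A u‖ ^ 2) (0 : F →L[ℝ] ℝ) 0 := by
    have h1 := (A.hasFDerivAt (x := 0)).norm_sq.const_mul c
    simpa using h1
  have hs := hl.hasFDerivAt.add hq
  rw [add_zero] at hs
  -- The left side of `h` is nonnegative, so the corrected function is minimal at `0` and stationary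
  -- there. Its increment is then `o(u)` and dominates `κ * ‖b u‖`.
  have hmin : IsLocalMin (l + fun u => c * ‖A u‖ ^ 2) 0 := by
    filter_upwards [h] with u hu
    have : 0 ≤ κ * ‖b u‖ := by positivity
    simp only [Pi.add_apply, map_zero, norm_zero]
    linarith
  have hl0 : fderiv ℝ l 0 = 0 := hmin.hasFDerivAt_eq_zero hs
  rw [hl0] at hs
  refine ⟨?_, hl0 ▸ hl.hasFDerivAt⟩
  rw [hasFDerivAt_iff_isLittleO_nhds_zero] at hs ⊢
  refine Asymptotics.IsBigO.trans_isLittleO ?_ hs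
  refine Asymptotics.IsBigO.of_bound κ⁻¹ ?_
  filter_upwards [h] with u hu
  rw [inv_mul_eq_div, le_div_iff₀ hκ]
  simp only [zero_add, hb, sub_zero, _root_.zero_apply, Pi.add_apply, map_zero,
    norm_zero]
  rw [mul_comm]
  refine hu.trans (le_trans (le_of_eq ?_) (Real.le_norm_self _))
  ring

end Graph

/-! ### Sharp growth and coordinates of the decomposition -/

section FastTrack

theorem eq_add_of_sub_eq_coe {a : EReal} {c l : ℝ} (h : a - (c : EReal) = (l : EReal)) :
    a = ((l + c : ℝ) : EReal) := by
  induction a using EReal.rec with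
  | bot => simp at h
  | top => simp at h
  | coe a =>
    norm_cast at h ⊢
    linarith

theorem coe_le_of_sub_le_sub {a b c d : ℝ} {z : EReal} (h : (a : EReal) - c ≤ z - d)
    (hb : b ≤ a - c + d) : (b : EReal) ≤ z := by
  induction z using EReal.rec with
  | bot => simp [← EReal.coe_sub] at h
  | top => exact le_top
  | coe z =>
    norm_cast at h ⊢
    linarith

variable {E : Type*} [NormedAddCommGroup E] [InnerProductSpace ℝ E]

theorem zero_mem_limSubdiff {f : E → EReal} {x₀ : E} (hx₀ : FiniteAt f x₀)
    (hmin : IsLocalMin f x₀) : 0 ∈ limSubdiff f x₀ := by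
  refine regSubdiff_subset_limSubdiff f x₀ (mem_regSubdiff_of_quadratic_bound 0 hx₀ ?_)
  filter_upwards [hmin] with x hx
  simpa [hx₀.coe_toReal] using hx

theorem limSubdiff_subset_vSpace {f : E → EReal} {x₀ : E} (h0 : 0 ∈ limSubdiff f x₀) :
    limSubdiff f x₀ ⊆ vSpace f x₀ := fun g hg => by
  have := vsub_mem_vectorSpan ℝ hg h0
  rwa [vsub_eq_sub, sub_zero] at this

/-- Quadratic growth up to the sharp term `ε ‖b‖` in the direction of `𝒱`. -/
theorem sharp_growth {f : E → EReal} {x₀ g : E} {r ρ ε : ℝ} (hε : 0 < ε)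
    (hprox : ∀ g ∈ limSubdiff f x₀, ProxRegularWith f x₀ g r ρ) (h0 : 0 ∈ limSubdiff f x₀)
    (hg : g ∈ epsRi f x₀ ε) {a b : E} (ha : a ∈ (vSpace f x₀)ᗮ) (hb : b ∈ vSpace f x₀)
    (hab : ‖a + b‖ ≤ r) :
    (((f x₀).toReal + inner ℝ g b + ε * ‖b‖ - ρ / 2 * (‖a‖ ^ 2 + ‖b‖ ^ 2) : ℝ) : EReal) ≤
      f (x₀ + a + b) := by
  have hsq : ‖a + b‖ ^ 2 = ‖a‖ ^ 2 + ‖b‖ ^ 2 := by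
    rw [norm_add_sq_real, Submodule.inner_left_of_mem_orthogonal hb ha]
    ring
  have key : ∀ w ∈ vSpace f x₀, ‖w‖ < ε →
      (((f x₀).toReal + inner ℝ (g + w) b - ρ / 2 * (‖a‖ ^ 2 + ‖b‖ ^ 2) : ℝ) : EReal) ≤
        f (x₀ + a + b) := by
    intro w hw hwε
    have hgw := hg w hw hwε
    obtain ⟨hloc, -, hr, -, h⟩ := hprox _ hgw
    have hlt : f x₀ < f x₀ + (r : EReal) := by
      rw [← hloc.1.coe_toReal]
      norm_cast
      linarith
    have h1 := h x₀ (g + w) hgw (by simpa using hr) (by simpa using hr) hlt (x₀ + a + b)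
      (by rwa [show x₀ + a + b - x₀ = a + b by abel])
    rwa [show x₀ + a + b - x₀ = a + b by abel, hsq, inner_add_right,
      Submodule.inner_right_of_mem_orthogonal (limSubdiff_subset_vSpace h0 hgw) ha, zero_add] at h1
  -- The perturbation `w` of norm `s` pointing along `b` gains `s * ‖b‖`. As `w` must have norm
  -- strictly below `ε`, the value `s = ε` is reached only as a limit.
  have key' : ∀ s ∈ Ico 0 ε,
      (((f x₀).toReal + inner ℝ g b + s * ‖b‖ - ρ / 2 * (‖a‖ ^ 2 + ‖b‖ ^ 2) : ℝ) : EReal) ≤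
        f (x₀ + a + b) := by
    rintro s ⟨hs0, hs⟩
    rcases eq_or_ne b 0 with rfl | hb0
    · simpa using key 0 (Submodule.zero_mem _) (by simpa using hε)
    · have hn : 0 < ‖b‖ := norm_pos_iff.2 hb0
      have h1 := key ((s / ‖b‖) • b) (Submodule.smul_mem _ _ hb)
        (by rw [norm_smul, Real.norm_of_nonneg (by positivity), div_mul_cancel₀ _ hn.ne']; exact hs)
      rw [inner_add_left, real_inner_smul_left, real_inner_self_eq_norm_sq] at h1
      have h2 : s / ‖b‖ * ‖b‖ ^ 2 = s * ‖b‖ := by field_simp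
      rwa [h2, ← add_assoc] at h1
  have hc : Continuous fun s : ℝ =>
      (((f x₀).toReal + inner ℝ g b + s * ‖b‖ - ρ / 2 * (‖a‖ ^ 2 + ‖b‖ ^ 2) : ℝ) : EReal) :=
    continuous_coe_real_ereal.comp (by fun_prop)
  refine le_of_tendsto ((hc.tendsto ε).mono_left (nhdsWithin_le_nhds (s := Iio ε))) ?_
  exact eventually_of_mem (Ico_mem_nhdsLT hε) key'

/-- From `s ≤ ε` one has `s ^ 2 ≤ ε * s`; for `ρ < 2` the linear growth therefore survives on the
whole search ball. -/
theorem sharp_bound {ε ρ s : ℝ} (hρ : 0 < ρ) (hs0 : 0 ≤ s) (hs : s ≤ ε) :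
    ε * (1 - ρ / 2) * s ≤ ε * s - ρ / 2 * s ^ 2 := by
  nlinarith [mul_le_mul_of_nonneg_left hs (mul_nonneg hρ.le hs0)]

variable {m p : ℕ} {f : E → EReal} {x₀ : E}

/-- `Ū` as a continuous linear map into the ambient space. -/
def uMap (Ubar : EuclideanSpace ℝ (Fin m) ≃ₗ[ℝ] uSpace f x₀) : EuclideanSpace ℝ (Fin m) →L[ℝ] E :=
  LinearMap.toContinuousLinearMap ((uSpace f x₀).subtype ∘ₗ Ubar.toLinearMap)

/-- `V̄` as a continuous linear map into the ambient space. -/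
def vMap (Vbar : EuclideanSpace ℝ (Fin p) ≃ₗ[ℝ] vSpace f x₀) : EuclideanSpace ℝ (Fin p) →L[ℝ] E :=
  LinearMap.toContinuousLinearMap ((vSpace f x₀).subtype ∘ₗ Vbar.toLinearMap)

theorem uMap_mem (Ubar : EuclideanSpace ℝ (Fin m) ≃ₗ[ℝ] uSpace f x₀)
    (u : EuclideanSpace ℝ (Fin m)) : uMap Ubar u ∈ (vSpace f x₀)ᗮ := (Ubar u).2

theorem vMap_mem (Vbar : EuclideanSpace ℝ (Fin p) ≃ₗ[ℝ] vSpace f x₀)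
    (w : EuclideanSpace ℝ (Fin p)) : vMap Vbar w ∈ vSpace f x₀ := (Vbar w).2

theorem uMap_injective (Ubar : EuclideanSpace ℝ (Fin m) ≃ₗ[ℝ] uSpace f x₀) :
    Function.Injective (uMap Ubar) := Subtype.val_injective.comp Ubar.injective

theorem vMap_injective (Vbar : EuclideanSpace ℝ (Fin p) ≃ₗ[ℝ] vSpace f x₀) :
    Function.Injective (vMap Vbar) := Subtype.val_injective.comp Vbar.injective

section wSet

variable {ε : ℝ} {Ubar : EuclideanSpace ℝ (Fin m) ≃ₗ[ℝ] uSpace f x₀}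
  {Vbar : EuclideanSpace ℝ (Fin p) ≃ₗ[ℝ] vSpace f x₀} {g : E} {u : EuclideanSpace ℝ (Fin m)}
  {w : EuclideanSpace ℝ (Fin p)}

theorem finiteAt_of_mem_wSet (hbot : ∀ x, f x ≠ ⊥) (hw : w ∈ wSet f x₀ ε Ubar Vbar g u) :
    FiniteAt f (x₀ + uMap Ubar u + vMap Vbar w) := by
  refine ⟨fun h => hw.2.1 ?_, hbot _⟩
  change f (x₀ + uMap Ubar u + vMap Vbar w) - ((inner ℝ g (vMap Vbar w) : ℝ) : EReal) = ⊤
  rw [h]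
  rfl

/-- Points of `W(u; g_v)` minimize `f - ⟪g, ·⟫` over the slice `x₀ + Ū u + {z ∈ 𝒱 | ‖z‖ ≤ ε}`. -/
theorem le_of_mem_wSet (hbot : ∀ x, f x ≠ ⊥) (hw : w ∈ wSet f x₀ ε Ubar Vbar g u) {z : E}
    (hz : z ∈ vSpace f x₀) (hzε : ‖z‖ ≤ ε) :
    (((f (x₀ + uMap Ubar u + vMap Vbar w)).toReal + inner ℝ g (z - vMap Vbar w) : ℝ) : EReal) ≤
      f (x₀ + uMap Ubar u + z) := by
  obtain ⟨w', hw'⟩ : ∃ w', vMap Vbar w' = z :=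
    ⟨Vbar.symm ⟨z, hz⟩, by
      change ((Vbar (Vbar.symm ⟨z, hz⟩) : vSpace f x₀) : E) = z
      rw [LinearEquiv.apply_symm_apply]⟩
  have h1 : lagObj f x₀ Ubar Vbar g u w ≤ lagObj f x₀ Ubar Vbar g u w' := by
    rw [hw.2.2]
    exact iInf₂_le w' (by
      change ‖vMap Vbar w'‖ ≤ ε
      rwa [hw'])
  change f (x₀ + uMap Ubar u + vMap Vbar w) - ((inner ℝ g (vMap Vbar w) : ℝ) : EReal) ≤
    f (x₀ + uMap Ubar u + vMap Vbar w') - ((inner ℝ g (vMap Vbar w') : ℝ) : EReal) at h1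
  rw [hw', ← (finiteAt_of_mem_wSet hbot hw).coe_toReal] at h1
  refine coe_le_of_sub_le_sub h1 (le_of_eq ?_)
  rw [inner_sub_right]
  ring

theorem eq_of_mem_wSet {l : ℝ} (hw : w ∈ wSet f x₀ ε Ubar Vbar g u)
    (hl : uLagrangian f x₀ ε Ubar Vbar g u = (l : EReal)) :
    f (x₀ + uMap Ubar u + vMap Vbar w) = ((l + inner ℝ g (vMap Vbar w) : ℝ) : EReal) :=
  eq_add_of_sub_eq_coe (hw.2.2.trans hl)

end wSet

variable [FiniteDimensional ℝ E]

/-- The coordinate of the projection onto `𝒰` in the basis `Ū`. -/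
def uCoord (Ubar : EuclideanSpace ℝ (Fin m) ≃ₗ[ℝ] uSpace f x₀) : E →L[ℝ] EuclideanSpace ℝ (Fin m) :=
  LinearMap.toContinuousLinearMap
    (Ubar.symm.toLinearMap ∘ₗ ((uSpace f x₀).orthogonalProjectionOnto : E →ₗ[ℝ] uSpace f x₀))

/-- The coordinate of the projection onto `𝒱` in the basis `V̄`. -/
def vCoord (Vbar : EuclideanSpace ℝ (Fin p) ≃ₗ[ℝ] vSpace f x₀) : E →L[ℝ] EuclideanSpace ℝ (Fin p) :=
  LinearMap.toContinuousLinearMap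
    (Vbar.symm.toLinearMap ∘ₗ ((vSpace f x₀).orthogonalProjectionOnto : E →ₗ[ℝ] vSpace f x₀))

theorem uMap_uCoord (Ubar : EuclideanSpace ℝ (Fin m) ≃ₗ[ℝ] uSpace f x₀) (x : E) :
    uMap Ubar (uCoord Ubar x) = (vSpace f x₀)ᗮ.starProjection x := by
  change ((Ubar (Ubar.symm ((uSpace f x₀).orthogonalProjectionOnto x)) : uSpace f x₀) : E) = _
  rw [LinearEquiv.apply_symm_apply]
  rfl

theorem vMap_vCoord (Vbar : EuclideanSpace ℝ (Fin p) ≃ₗ[ℝ] vSpace f x₀) (x : E) :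
    vMap Vbar (vCoord Vbar x) = (vSpace f x₀).starProjection x := by
  change ((Vbar (Vbar.symm ((vSpace f x₀).orthogonalProjectionOnto x)) : vSpace f x₀) : E) = _
  rw [LinearEquiv.apply_symm_apply]
  rfl

theorem uCoord_uMap (Ubar : EuclideanSpace ℝ (Fin m) ≃ₗ[ℝ] uSpace f x₀)
    (u : EuclideanSpace ℝ (Fin m)) : uCoord Ubar (uMap Ubar u) = u := by
  apply uMap_injective Ubar
  rw [uMap_uCoord, Submodule.starProjection_eq_self_iff.2 (uMap_mem Ubar u)]

theorem vCoord_vMap (Vbar : EuclideanSpace ℝ (Fin p) ≃ₗ[ℝ] vSpace f x₀)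
    (w : EuclideanSpace ℝ (Fin p)) : vCoord Vbar (vMap Vbar w) = w := by
  apply vMap_injective Vbar
  rw [vMap_vCoord, Submodule.starProjection_eq_self_iff.2 (vMap_mem Vbar w)]

theorem vCoord_uMap (Ubar : EuclideanSpace ℝ (Fin m) ≃ₗ[ℝ] uSpace f x₀)
    (Vbar : EuclideanSpace ℝ (Fin p) ≃ₗ[ℝ] vSpace f x₀) (u : EuclideanSpace ℝ (Fin m)) :
    vCoord Vbar (uMap Ubar u) = 0 := by
  apply vMap_injective Vbar
  rw [vMap_vCoord, map_zero, Submodule.starProjection_apply_eq_zero_iff]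
  exact uMap_mem Ubar u

theorem uMap_uCoord_add_vMap_vCoord (Ubar : EuclideanSpace ℝ (Fin m) ≃ₗ[ℝ] uSpace f x₀)
    (Vbar : EuclideanSpace ℝ (Fin p) ≃ₗ[ℝ] vSpace f x₀) (x : E) :
    uMap Ubar (uCoord Ubar x) + vMap Vbar (vCoord Vbar x) = x := by
  rw [uMap_uCoord, vMap_vCoord, add_comm, Submodule.starProjection_add_starProjection_orthogonal]

end FastTrack

/-! ### Semicontinuity of the subdifferential along the graph -/

section Continuity

variable {E F : Type*} [NormedAddCommGroup E] [InnerProductSpace ℝ E] [FiniteDimensional ℝ E]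
  [NormedAddCommGroup F] [NormedSpace ℝ F]

/-- `f` coincides along the graph `M` with a function `φ` of the parameter that is `C^1` near `0` and
stationary at `0`, and is subdifferentially regular at the points of `M` near `x₀`. -/
structure IsSmoothAlong (f : E → EReal) (x₀ : E) (M : Set E) (A : F →L[ℝ] E) (b : F → E)
    (φ : F → ℝ) : Prop where
  subset_graph : ∀ x ∈ M, ∃ u, x = x₀ + A u + b u
  regular : ∀ᶠ x in 𝓝[M] x₀, SubdiffRegularAt f x
  eq : ∀ᶠ u in 𝓝 0, f (x₀ + A u + b u) = (φ u : EReal)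
  differentiableAt : ∀ᶠ u in 𝓝 0, DifferentiableAt ℝ φ u
  continuousAt_fderiv : ContinuousAt (fderiv ℝ φ) 0
  fderiv_zero : fderiv ℝ φ 0 = 0

variable {K : Submodule ℝ E} {A : F →L[ℝ] E} {π : E →L[ℝ] F} {b : F → E} {f : E → EReal} {x₀ : E}
  {M : Set E} {φ : F → ℝ}

theorem IsSmoothAlong.eq_param (hS : IsSmoothAlong f x₀ M A b φ) (hG : IsTangentGraph K A π b)
    {x : E} (hx : x ∈ M) : x = x₀ + A (π (x - x₀)) + b (π (x - x₀)) := by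
  obtain ⟨u, rfl⟩ := hS.subset_graph x hx
  rw [hG.coord_sub]

/-- Continuity of `f` along `M` makes the convergence `f`-attentive, and regularity makes the
subgradients regular ones, so a tail of the given sequence is itself a witness. -/
theorem IsSmoothAlong.outerLimit_subset (hS : IsSmoothAlong f x₀ M A b φ)
    (hG : IsTangentGraph K A π b) : outerLimit (limSubdiff f) M x₀ ⊆ limSubdiff f x₀ := by
  rintro y ⟨xs, ys, hxsM, hxs, hys, hy⟩
  have hu := IsTangentGraph.tendsto_coord (π := π) hxs
  have hf0 : f x₀ = (φ 0 : EReal) := by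
    simpa [hG.zero] using hS.eq.self_of_nhds
  have hfx : Tendsto (fun j => f (xs j)) atTop (𝓝 (f x₀)) := by
    rw [hf0]
    have h1 : Tendsto (fun j => ((φ (π (xs j - x₀)) : ℝ) : EReal)) atTop (𝓝 (φ 0 : EReal)) :=
      ((continuous_coe_real_ereal.tendsto _).comp
        hS.differentiableAt.self_of_nhds.continuousAt.tendsto).comp hu
    refine h1.congr' ?_
    filter_upwards [hu.eventually hS.eq] with j hj
    rw [← hj, ← hS.eq_param hG (hxsM j)]
  have hreg : ∀ᶠ j in atTop, SubdiffRegularAt f (xs j) :=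
    (tendsto_nhdsWithin_iff.2 ⟨hxs, .of_forall hxsM⟩).eventually hS.regular
  obtain ⟨N, hN⟩ := eventually_atTop.1 hreg
  refine ⟨by rw [FiniteAt, hf0]; exact ⟨EReal.coe_ne_top _, EReal.coe_ne_bot _⟩,
    fun j => xs (j + N), fun j => ys (j + N), hxs.comp (tendsto_add_atTop_nat N),
    hfx.comp (tendsto_add_atTop_nat N), fun j => ?_, hy.comp (tendsto_add_atTop_nat N)⟩
  rw [← (hN (j + N) (by omega)).limSubdiff_eq]
  exact hys _

/-- Subgradients whose projections onto `K` converge to `g` along `M` converge to `g`. -/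
theorem IsSmoothAlong.mem_innerLimit (hS : IsSmoothAlong f x₀ M A b φ)
    (hG : IsTangentGraph K A π b) {g : E}
    (hg : g ∈ innerLimit (fun x => K.starProjection '' limSubdiff f x) M x₀) :
    g ∈ innerLimit (limSubdiff f) M x₀ := by
  classical
  intro xs hxsM hxs
  obtain ⟨ps, hps, hplim⟩ := hg xs hxsM hxs
  set ys : ℕ → E := fun j =>
    if h : ps j ∈ K.starProjection '' limSubdiff f (xs j) then h.choose else 0 with hys
  have hy : ∀ᶠ j in atTop, ys j ∈ limSubdiff f (xs j) ∧ K.starProjection (ys j) = ps j := by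
    filter_upwards [hps] with j hj
    have hj : ps j ∈ K.starProjection '' limSubdiff f (xs j) := hj
    simp only [hys, dif_pos hj]
    exact hj.choose_spec
  refine ⟨ys, hy.mono fun j hj => hj.1, ?_⟩
  have hu := IsTangentGraph.tendsto_coord (π := π) hxs
  have hreg : ∀ᶠ j in atTop, SubdiffRegularAt f (xs j) :=
    (tendsto_nhdsWithin_iff.2 ⟨hxs, .of_forall hxsM⟩).eventually hS.regular
  have hbound : Tendsto (fun j => (‖fderiv ℝ φ (π (xs j - x₀))‖ +
      ‖ps j‖ * ‖fderiv ℝ b (π (xs j - x₀))‖) * ‖π‖) atTop (𝓝 0) := by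
    have h1 := (hS.continuousAt_fderiv.tendsto.comp hu).norm
    have h2 := (hG.continuousAt_fderiv.tendsto.comp hu).norm
    rw [hS.fderiv_zero, norm_zero] at h1
    rw [hG.fderiv_zero, norm_zero] at h2
    have h3 := (h1.add (hplim.norm.mul h2)).mul_const ‖π‖
    rwa [mul_zero, add_zero, zero_mul] at h3
  -- Both derivatives in the bound vanish at `0` and are continuous there, while the `K`-components
  -- `ps j` converge and so stay bounded.
  have hQ : Tendsto (fun j => Kᗮ.starProjection (ys j)) atTop (𝓝 0) := by
    refine squeeze_zero_norm' ?_ hbound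
    filter_upwards [hy, hreg, hu.eventually hG.differentiableAt,
      hu.eventually hS.differentiableAt, hu.eventually hS.eq.eventually_nhds] with j h1 h2 h3 h4 h5
    rw [← h1.2]
    refine hG.norm_starProjection_orthogonal_le h3 h4 h5 ?_
    rw [← hS.eq_param hG (hxsM j), ← h2.limSubdiff_eq]
    exact h1.1
  have hsum := hplim.add hQ
  rw [add_zero] at hsum
  refine hsum.congr' ?_
  filter_upwards [hy] with j hj
  rw [← hj.2, Submodule.starProjection_add_starProjection_orthogonal]

end Continuity

/-! ### Tangency of the fast track and recovery of subgradients -/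

section FastTrack

variable {E : Type*} [NormedAddCommGroup E] [InnerProductSpace ℝ E]
  {m p : ℕ} {f : E → EReal} {x₀ : E}
  {Ubar : EuclideanSpace ℝ (Fin m) ≃ₗ[ℝ] uSpace f x₀}
  {Vbar : EuclideanSpace ℝ (Fin p) ≃ₗ[ℝ] vSpace f x₀}
  {v : EuclideanSpace ℝ (Fin m) → EuclideanSpace ℝ (Fin p)}

theorem isOpen_norm_uMap_lt (Ubar : EuclideanSpace ℝ (Fin m) ≃ₗ[ℝ] uSpace f x₀) (η : ℝ) :
    IsOpen {u | ‖uMap Ubar u‖ < η} :=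
  isOpen_lt (uMap Ubar).continuous.norm continuous_const

theorem setOf_norm_uMap_lt_mem_nhds (Ubar : EuclideanSpace ℝ (Fin m) ≃ₗ[ℝ] uSpace f x₀) {η : ℝ}
    (hη : 0 < η) : {u | ‖uMap Ubar u‖ < η} ∈ 𝓝 0 :=
  (isOpen_norm_uMap_lt Ubar η).mem_nhds (by simpa using hη)

variable [FiniteDimensional ℝ E]

/-- A smooth selection of minimizers is tangent to `𝒰`, and the `𝒰`-Lagrangian is stationary. -/
theorem isTangentGraph_of_wSet {k : ℕ∞} (hk : 1 ≤ k) {ε r ρ η : ℝ}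
    (hx₀ : FiniteAt f x₀)
    (hprox : ∀ g ∈ limSubdiff f x₀, ProxRegularWith f x₀ g r ρ) (h0 : 0 ∈ limSubdiff f x₀)
    (hε : 0 < ε) (hεr : ε < r) (hρ : 0 < ρ) (hρ2 : ρ < 2) (hη : 0 < η)
    (hv : ContDiffOn ℝ k v {u | ‖uMap Ubar u‖ < η}) {g : E} (hg : g ∈ epsRi f x₀ ε)
    (hW : ∀ u, ‖uMap Ubar u‖ < η → v u ∈ wSet f x₀ ε Ubar Vbar g u)
    {l : EuclideanSpace ℝ (Fin m) → ℝ} (hl : ContDiffOn ℝ k l {u | ‖uMap Ubar u‖ < η})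
    (hlL : ∀ u, ‖uMap Ubar u‖ < η → uLagrangian f x₀ ε Ubar Vbar g u = (l u : EReal)) :
    IsTangentGraph (vSpace f x₀) (uMap Ubar) (uCoord Ubar) (fun u => vMap Vbar (v u)) ∧
      fderiv ℝ l 0 = 0 := by
  have hk0 : ((k : ℕ∞) : WithTop ℕ∞) ≠ 0 := by
    have : k ≠ 0 := by
      rintro rfl
      simp at hk
    exact_mod_cast this
  have hk1 : (1 : WithTop ℕ∞) ≤ ((k : ℕ∞) : WithTop ℕ∞) := by exact_mod_cast hk
  have hSo := isOpen_norm_uMap_lt Ubar η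
  have hS := setOf_norm_uMap_lt_mem_nhds Ubar hη
  -- With the `𝒰`-step below `r - ε` and the `𝒱`-step at most `ε`, the point stays in the ball of
  -- radius `r` where prox-regularity applies.
  have hS' := setOf_norm_uMap_lt_mem_nhds Ubar (sub_pos.2 hεr)
  have hκ : 0 < ε * (1 - ρ / 2) := mul_pos hε (by linarith)
  have hb : ContDiffOn ℝ k (fun u => vMap Vbar (v u)) {u | ‖uMap Ubar u‖ < η} :=
    (vMap Vbar).contDiff.comp_contDiffOn hv
  have hgrow : ∀ u, ‖uMap Ubar u‖ < η → ‖uMap Ubar u‖ < r - ε →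
      (f x₀).toReal + ε * (1 - ρ / 2) * ‖vMap Vbar (v u)‖ ≤
        l u + ρ / 2 * ‖uMap Ubar u‖ ^ 2 := by
    intro u hu hu'
    have hw := hW u hu
    have hwε : ‖vMap Vbar (v u)‖ ≤ ε := hw.1
    have h1 := sharp_growth hε hprox h0 hg (uMap_mem Ubar u) (vMap_mem Vbar (v u))
      ((norm_add_le _ _).trans (by linarith))
    rw [eq_of_mem_wSet hw (hlL u hu), EReal.coe_le_coe_iff] at h1
    have h2 := sharp_bound hρ (norm_nonneg _) hwε
    linarith
  have hA0 : ‖uMap Ubar 0‖ = 0 := by simp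
  -- Testing the infimum with the zero step; together with the growth bound at `u = 0` this forces
  -- the minimizer `v 0` to vanish.
  have hl0le : l 0 ≤ (f x₀).toReal := by
    have h1 := hlL 0 (by rwa [hA0])
    have h2 : uLagrangian f x₀ ε Ubar Vbar g 0 ≤ lagObj f x₀ Ubar Vbar g 0 0 :=
      iInf₂_le 0 (by simpa using hε.le)
    rw [h1] at h2
    simp only [lagObj, map_zero, ZeroMemClass.coe_zero, add_zero, inner_zero_right,
      EReal.coe_zero, sub_zero] at h2
    rw [← hx₀.coe_toReal] at h2
    exact EReal.coe_le_coe_iff.1 h2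
  have hgrow0 := hgrow 0 (by rwa [hA0]) (by rw [hA0]; linarith)
  rw [hA0] at hgrow0
  have hb0 : vMap Vbar (v 0) = 0 := by
    have : ε * (1 - ρ / 2) * ‖vMap Vbar (v 0)‖ ≤ 0 := by linarith
    exact norm_le_zero_iff.1 (nonpos_of_mul_nonpos_right this hκ)
  have hmain := hasFDerivAt_zero_of_norm_le (A := uMap Ubar) (b := fun u => vMap Vbar (v u))
    (c := ρ / 2) hκ ((hl.differentiableOn hk0).differentiableAt hS) (by
      filter_upwards [hS, hS'] with u hu hu'
      have := hgrow u hu hu'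
      linarith) hb0
  refine ⟨⟨uMap_mem Ubar, uMap_uCoord Ubar, uCoord_uMap Ubar, fun u => vMap_mem Vbar (v u), hb0,
    ?_, ?_, hmain.1.fderiv⟩, hmain.2.fderiv⟩
  · filter_upwards [hSo.mem_nhds (mem_of_mem_nhds hS)] with u hu
    exact (hb.differentiableOn hk0).differentiableAt (hSo.mem_nhds hu)
  · exact (hb.continuousOn_fderiv_of_isOpen hSo hk1).continuousAt hS

/-- At a point of the graph whose `𝒱`-component is an interior minimizer for `g`, the vector `g` is
the projection of a subgradient. -/
theorem exists_limSubdiff_starProjection_eq {ε : ℝ} (hlsc : LowerSemicontinuous f)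
    (hbot : ∀ x, f x ≠ ⊥)
    (hG : IsTangentGraph (vSpace f x₀) (uMap Ubar) (uCoord Ubar) fun u => vMap Vbar (v u))
    {φ : EuclideanSpace ℝ (Fin m) → ℝ} {u : EuclideanSpace ℝ (Fin m)}
    (hb : DifferentiableAt ℝ (fun u => vMap Vbar (v u)) u) (hφ : DifferentiableAt ℝ φ u)
    (hf : ∀ᶠ u' in 𝓝 u, f (x₀ + uMap Ubar u' + vMap Vbar (v u')) = (φ u' : EReal))
    (hreg : SubdiffRegularAt f (x₀ + uMap Ubar u + vMap Vbar (v u))) {g : E}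
    (hw : v u ∈ wSet f x₀ ε Ubar Vbar g u) (hint : ‖vMap Vbar (v u)‖ < ε) :
    ∃ y ∈ limSubdiff f (x₀ + uMap Ubar u + vMap Vbar (v u)),
      (vSpace f x₀).starProjection y = (vSpace f x₀).starProjection g := by
  rcases exists_limSubdiff_or_horizontal_normal hlsc hbot (vSpace f x₀) (g := g) hreg.1
    (sub_pos.2 hint) (fun z hz hzr => by
      have h1 := le_of_mem_wSet hbot hw (Submodule.add_mem _ (vMap_mem Vbar (v u)) hz)
        ((norm_add_le _ _).trans (by linarith))
      rwa [add_sub_cancel_left, ← add_assoc] at h1) with h | ⟨e, he, hne, hn⟩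
  · exact h
  -- Clarke regularity turns the limiting horizontal normal into a regular one, to which the
  -- tangency identity applies at this very point.
  · rw [hreg.2.2.2] at hn
    rw [hG.eq_zero_of_horizontal_normal hb hφ hf he hn, norm_zero] at hne
    exact absurd hne zero_ne_one

end FastTrack

end UVDecomp

end

/-! ### Partial smoothness of the fast track -/

open UVDecomp
theorem mainTheorem3 (n m p : ℕ) (k : ℕ∞) (hk : 1 ≤ k)
    (f : EuclideanSpace ℝ (Fin n) → EReal) (xbar : EuclideanSpace ℝ (Fin n))
    -- proper, lower semicontinuous, properly prox-regular with constants `εbar` and `ρ`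
    (εbar ρ : ℝ) (hproper : Proper f) (hlsc : LowerSemicontinuous f)
    (hprox : ProperlyProxRegularWith f xbar εbar ρ)
    -- constants
    (ε : ℝ) (hε : 0 < ε) (hεbar : ε < εbar) (hρ : 0 < ρ ∧ ρ < 2)
    (gbar : EuclideanSpace ℝ (Fin n)) (hgbar : gbar ∈ epsRi f xbar ε)
    -- local minimizer and fast track
    (hmin : IsLocalMin f xbar)
    (Ubar : EuclideanSpace ℝ (Fin m) ≃ₗ[ℝ] uSpace f xbar)
    (Vbar : EuclideanSpace ℝ (Fin p) ≃ₗ[ℝ] vSpace f xbar)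
    (δ : ℝ) (v : EuclideanSpace ℝ (Fin m) → EuclideanSpace ℝ (Fin p))
    (M : Set (EuclideanSpace ℝ (Fin n)))
    (hM : IsFastTrack k f xbar ε Ubar Vbar δ v M)
    -- interior minimizers
    (hint : ∃ τ : ℝ, 0 < τ ∧ τ ≤ δ ∧
      ∀ u, ‖(Ubar u : EuclideanSpace ℝ (Fin n))‖ ≤ τ →
        (wSet f xbar ε Ubar Vbar gbar u ∩
          {w | ‖(Vbar w : EuclideanSpace ℝ (Fin n))‖ < ε}).Nonempty ∧
        ‖(Vbar (v u) : EuclideanSpace ℝ (Fin n))‖ < ε)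
    -- inner limit condition for the subgradients outside the `ε`-relative interior
    (hinner : (vSpace f xbar).starProjection '' (limSubdiff f xbar \ epsRi f xbar ε) ⊆
      innerLimit (fun x => (vSpace f xbar).starProjection '' limSubdiff f x) M xbar)
    -- regularity and existence of subgradients along `M` near `xbar`
    (hreg : ∃ δbar : ℝ, 0 < δbar ∧ ∀ x ∈ Metric.closedBall xbar δbar ∩ M,
      SubdiffRegularAt f x ∧ (limSubdiff f x).Nonempty) :
    PartlySmooth k f xbar M := by
  obtain ⟨hloc, -, -, hprox, -⟩ := hprox
  obtain ⟨hδ, hMeq, η, hη, hv, hW, ghat, hghat, l, hl, hlL⟩ := hM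
  obtain ⟨τ, hτ, -, hint⟩ := hint
  obtain ⟨δbar, hδbar, hreg⟩ := hreg
  have hbot := hproper.1
  have hMeq' : M = {x | ∃ u, ‖uMap Ubar u‖ ≤ δ ∧ x = xbar + uMap Ubar u + vMap Vbar (v u)} := hMeq
  have hv' : ContDiffOn ℝ k v {u | ‖uMap Ubar u‖ < η} := hv
  have hl' : ContDiffOn ℝ k l {u | ‖uMap Ubar u‖ < η} := hl
  have h0 := zero_mem_limSubdiff hloc.1 hmin
  have hDK := limSubdiff_subset_vSpace h0
  obtain ⟨hG, hl0⟩ := isTangentGraph_of_wSet hk hloc.1 hprox h0 hε hεbar hρ.1 hρ.2 hη hv'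
    hghat (fun u hu => hW u hu ghat hghat) hl' hlL
  set φ : EuclideanSpace ℝ (Fin m) → ℝ := fun u => l u + inner ℝ ghat (vMap Vbar (v u)) with hφdef
  have hφ : ContDiffOn ℝ k φ {u | ‖uMap Ubar u‖ < η} :=
    hl'.add (contDiffOn_const.inner ℝ ((vMap Vbar).contDiff.comp_contDiffOn hv'))
  have hφeq : ∀ u, ‖uMap Ubar u‖ < η → f (xbar + uMap Ubar u + vMap Vbar (v u)) = (φ u : EReal) :=
    fun u hu => eq_of_mem_wSet (hW u hu ghat hghat) (hlL u hu)
  have hSo := isOpen_norm_uMap_lt Ubar η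
  have hS := setOf_norm_uMap_lt_mem_nhds Ubar hη
  have hk0 : ((k : ℕ∞) : WithTop ℕ∞) ≠ 0 := by
    have : k ≠ 0 := by
      rintro rfl
      simp at hk
    exact_mod_cast this
  have hk1 : (1 : WithTop ℕ∞) ≤ ((k : ℕ∞) : WithTop ℕ∞) := by exact_mod_cast hk
  have hregM : ∀ᶠ x in 𝓝[M] xbar, SubdiffRegularAt f x ∧ (limSubdiff f x).Nonempty := by
    filter_upwards [nhdsWithin_le_nhds (Metric.closedBall_mem_nhds xbar hδbar),
      self_mem_nhdsWithin] with x hx hxM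
    exact hreg x ⟨hx, hxM⟩
  have hSm : IsSmoothAlong f xbar M (uMap Ubar) (fun u => vMap Vbar (v u)) φ := by
    refine ⟨fun x hx => ?_, hregM.mono fun x hx => hx.1, ?_, ?_, ?_, ?_⟩
    · rw [hMeq'] at hx
      obtain ⟨u, -, hu⟩ := hx
      exact ⟨u, hu⟩
    · filter_upwards [hS] with u hu using hφeq u hu
    · filter_upwards [hS] with u hu
      exact (hφ.differentiableOn hk0).differentiableAt (hSo.mem_nhds hu)
    · exact (hφ.continuousOn_fderiv_of_isOpen hSo hk1).continuousAt hS
    · have h1 := ((hl'.differentiableOn hk0).differentiableAt hS).hasFDerivAt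
      have h2 := (innerSL ℝ ghat).hasFDerivAt.comp (0 : EuclideanSpace ℝ (Fin m))
        hG.differentiableAt.self_of_nhds.hasFDerivAt
      rw [hl0] at h1
      rw [hG.fderiv_zero, ContinuousLinearMap.comp_zero] at h2
      have h3 := h1.add h2
      rw [add_zero] at h3
      exact h3.fderiv
  refine ⟨⟨p, isManifoldAround_graph (vMap Vbar) (vCoord Vbar) hG (vCoord_uMap Ubar Vbar)
    (vCoord_vMap Vbar) (uMap_uCoord_add_vMap_vCoord Ubar Vbar) hδ hη hv' hMeq'⟩, ?_, hregM,
    hG.limNormal_eq hδ hMeq', ?_, hSm.outerLimit_subset hG⟩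
  -- The smooth extension of `f` off `M` is constant along `𝒱`: it reads off the `𝒰`-coordinate and
  -- applies `φ`.
  · refine ⟨{y | ‖uMap Ubar (uCoord Ubar (y - xbar))‖ < η},
      isOpen_lt (by fun_prop) continuous_const, by simpa using hη,
      fun y => φ (uCoord Ubar (y - xbar)), hφ.comp (by fun_prop) fun y hy => hy, ?_⟩
    rintro x ⟨hxM, hx⟩
    conv_lhs => rw [hSm.eq_param hG hxM]
    exact hφeq _ hx
  · intro g hg
    refine hSm.mem_innerLimit hG ?_
    by_cases hgr : g ∈ epsRi f xbar ε
    · intro xs hxsM hxs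
      have hu := IsTangentGraph.tendsto_coord (π := uCoord Ubar) hxs
      have hτ' := setOf_norm_uMap_lt_mem_nhds Ubar hτ
      have hregs : ∀ᶠ j in atTop, SubdiffRegularAt f (xs j) :=
        (tendsto_nhdsWithin_iff.2 ⟨hxs, .of_forall hxsM⟩).eventually hSm.regular
      -- A constant sequence suffices: since `g` lies in `𝒱`, it is itself the projection of a
      -- subgradient at every point of `M` close to `xbar`.
      refine ⟨fun _ => g, ?_, tendsto_const_nhds⟩
      filter_upwards [hregs, hu.eventually hS, hu.eventually hτ', hu.eventually hG.differentiableAt,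
        hu.eventually hSm.differentiableAt, hu.eventually hSm.eq.eventually_nhds]
        with j h1 h2 h3 h4 h5 h6
      rw [hSm.eq_param hG (hxsM j)] at h1
      obtain ⟨y, hy, hyg⟩ := exists_limSubdiff_starProjection_eq hlsc hbot hG h4 h5 h6 h1
        (hW _ h2 g hgr) (hint _ (le_of_lt h3)).2
      rw [← hSm.eq_param hG (hxsM j)] at hy
      exact ⟨y, hy, hyg.trans (Submodule.starProjection_eq_self_iff.2 (hDK hg))⟩
    · have h1 := hinner ⟨g, ⟨hg, hgr⟩, rfl⟩
      rwa [Submodule.starProjection_eq_self_iff.2 (hDK hg)] at h1
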